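/- **Theorem (privacy upper bound for Noisy-SGD).** There is a universal constant $C>0$ such that the following holds. Let $\mathcal K\subset\mathbb R^d$ be a closed, bounded, convex set of diameter $D$, let $L,M>0$, and let each data point $x$ of a data universe define a differentiable loss function $f_x:\mathcal K\to\mathbb R$ that is convex, $L$-Lipschitz ($|f_x(\omega)-f_x(\omega')|\le L\|\omega-\omega'\|$) and $M$-smooth ($\|\nabla f_x(\omega)-\nabla f_x(\omega')\|\le M\|\omega-\omega'\|$) on $\mathcal K$. Let $T\ge 0$ be a number of iterations, $n$ a dataset size, $1\le b\le n$ a batch size, $0<\eta\le 2/M$ a stepsize, $\sigma>8\sqrt2\,L/b$ a noise parameter, and $\omega_0\in\mathcal K$ an initialization. On a dataset $(x_1,\dots,x_n)$, Noisy-SGD starts from $\omega_0$, performs the updates $$\omega_{t+1}=\Pi_{\mathcal K}\Big[\omega_t-\eta\Big(\tfrac1b\sum_{i\in B_t}\nabla f_{x_i}(\omega_t)+Z_t\Big)\Big],\qquad t=0,\dots,T-1,$$ and outputs $\omega_T$. Here $\Pi_{\mathcal K}$ is the Euclidean projection onto $\mathcal K$, each $B_t$ is a uniformly random subset of $\{1,\dots,n\}$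 of size $b$, each $Z_t\sim\mathcal N(0,\sigma^2I_d)$, and all the $B_t$ and $Z_t$ are independent. For $q\in(0,1]$ and $s>0$ let $\alpha^*(q,s)$ be the largest $\alpha>1$ satisfying both $$\alpha\le \tfrac12 \Lambda s^2-\log(s^2)\qquad\text{and}\qquad \alpha\le\frac{\frac12\Lambda^2s^2-\log(5s^2)}{\Lambda+\log(q\alpha)+1/(2s^2)},\qquad\text{where } \Lambda=\log\Big(1+\frac1{q(\alpha-1)}\Big).$$ Then for every $\alpha$ with $1<\alpha\le\alpha^*\big(\tfrac bn,\tfrac{b\sigma}{2\sqrt2L}\big)$, Noisy-SGD satisfies $(\alpha,\varepsilon)$-Rényi differential privacy with $$\varepsilon= C\,\frac{\alpha L^2}{n^2\sigma^2}\,\min\{T,\bar T\},\qquad \bar T=\Big\lceil\frac{Dn}{L\eta}\Big\rceil .$$ That is, for any two datasets of size $n$ that differ in at most one data point, the laws $\mu,\nu$ of the corresponding outputs satisfy $\mathcal D_\alpha(\mu\|\nu)\le\varepsilon$, where $\mathcal D_\alpha(\mu\|\nu)=\frac1{\alpha-1}\log\int\big(\frac{d\mu}{d\nu}\big)^\alpha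 d\nu$ if $\mu\ll\nu$, and $\infty$ otherwise. -/

import Mathlib

open MeasureTheory ProbabilityTheory
open scoped ENNReal

namespace NoisySGD

noncomputable section

/-- The Rényi divergence `D_α(μ ‖ ν) = (α - 1)⁻¹ log ∫ (dμ/dν)^α dν` of order `α ∈ (1, ∞)` if
`μ ≪ ν`, and `∞` otherwise. It takes values in the extended reals, so that an infinite integral
gives an infinite divergence. -/
def renyiDiv {Ω : Type*} [MeasurableSpace Ω] (α : ℝ) (μ ν : Measure Ω) : EReal :=
  open Classical in
  if μ ≪ ν then
    (((α - 1)⁻¹ : ℝ) : EReal) * ENNReal.log (∫⁻ x, (μ.rnDeriv ν x) ^ α ∂ν)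
  else ⊤

/-- Two datasets of size `n` are (replace-)adjacent if they differ in at most one data point. -/
def Adjacent {n : ℕ} {𝒳 : Type*} (X X' : Fin n → 𝒳) : Prop :=
  X = X' ∨ ∃ i, ∀ j, j ≠ i → X j = X' j

/-- `(α, ε)`-Rényi differential privacy of a randomized algorithm `A`, which maps a dataset to the
law of its output. -/
def IsRDP {n : ℕ} {𝒳 Ω : Type*} [MeasurableSpace Ω] (A : (Fin n → 𝒳) → Measure Ω)
    (α ε : ℝ) : Prop :=
  ∀ X X' : Fin n → 𝒳, Adjacent X X' → renyiDiv α (A X) (A X') ≤ (ε : EReal)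

/-- The parameters `α > 1` that satisfy the two inequalities defining `alphaStar q s`, where
`M = log (1 + 1 / (q (α - 1)))`. -/
def alphaSet (q s : ℝ) : Set ℝ :=
  {α : ℝ | 1 < α ∧
    α ≤ Real.log (1 + 1 / (q * (α - 1))) * s ^ 2 / 2 - Real.log (s ^ 2) ∧
    α ≤ (Real.log (1 + 1 / (q * (α - 1))) ^ 2 * s ^ 2 / 2 - Real.log (5 * s ^ 2)) /
      (Real.log (1 + 1 / (q * (α - 1))) + Real.log (q * α) + 1 / (2 * s ^ 2))}

/-- `α^*(q, s)`: the largest `α` that satisfies the two inequalities of `alphaSet q s`. -/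
def alphaStar (q s : ℝ) : ℝ := sSup (alphaSet q s)

section Euclidean

variable {E : Type*} [NormedAddCommGroup E] [InnerProductSpace ℝ E] [CompleteSpace E]

/-- `f` is a convex, differentiable, `L`-Lipschitz and `M`-smooth function on `K`, with gradient
`g`. Derivatives are taken within `K`: nothing is required of `f` outside of `K`. If `K` has
nonempty interior, the gradient `g` is determined on `K` by `f`. -/
structure IsLoss (K : Set E) (L M : ℝ) (f : E → ℝ) (g : E → E) : Prop where
  convex : ConvexOn ℝ K f
  grad : ∀ w ∈ K, HasGradientWithinAt f (g w) K w
  lipschitz : ∀ w ∈ K, ∀ w' ∈ K, |f w - f w'| ≤ L * ‖w - w'‖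
  smooth : ∀ w ∈ K, ∀ w' ∈ K, ‖g w - g w'‖ ≤ M * ‖w - w'‖

/-- Euclidean projection of `x` onto `K`: the point of `K` nearest to `x`, which exists and is
unique if `K` is nonempty, closed and convex in a Euclidean space. -/
def proj (K : Set E) (x : E) : E :=
  open Classical in
  if h : ∃ y ∈ K, ∀ y' ∈ K, dist x y ≤ dist x y' then h.choose else x

/-- One update `w ↦ Π_K [w - η (G + z)]`, where `G` is the average over the batch `B` of the
gradients `g i` at `w`, and `z` is the noise. -/
def step {n : ℕ} (K : Set E) (η : ℝ) (g : Fin n → E → E) (B : Finset (Fin n)) (w z : E) : E :=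
  proj K (w - η • (((B.card : ℝ)⁻¹ • (∑ i ∈ B, g i w)) + z))

variable [FiniteDimensional ℝ E] [MeasurableSpace E]

variable (E) in
/-- The isotropic Gaussian `N(0, σ² I)` on `E`. -/
def gaussianNoise (σ : ℝ) : Measure E := (stdGaussian E).map (fun z => σ • z)

/-- The law of the iterate `W_T` of Noisy-SGD. We have `W_0 = w₀` and
`W_{t+1} = step K η g B_t W_t Z_t`, where `W_t`, `B_t`, `Z_t` are independent, the batch `B_t` is
uniform on the `(n choose b)` subsets of size `b` of the index set, and `Z_t ∼ N(0, σ² I)`. -/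
def sgdLaw {n : ℕ} (K : Set E) (η σ : ℝ) (b : ℕ) (g : Fin n → E → E) (w₀ : E) : ℕ → Measure E
  | 0 => Measure.dirac w₀
  | t + 1 => ((n.choose b : ℝ≥0∞)⁻¹) • ∑ B ∈ (Finset.univ : Finset (Fin n)).powersetCard b,
      ((sgdLaw K η σ b g w₀ t).prod (gaussianNoise E σ)).map
        (fun p : E × E => step K η g B p.1 p.2)

/-- Noisy-SGD with `T` iterations as a randomized algorithm on datasets of size `n`: a data point
`x` contributes the loss with gradient `g x`, and the output is the final iterate. -/
def noisySGD {n : ℕ} {𝒳 : Type*} (K : Set E) (η σ : ℝ) (b : ℕ) (g : 𝒳 → E → E) (w₀ : E) (T : ℕ)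
    (X : Fin n → 𝒳) : Measure E :=
  sgdLaw K η σ b (fun i => g (X i)) w₀ T

end Euclidean

end

end NoisySGD

/-! Let p be the conjugate exponent of α. If ∫ f dμ ≤ e^t (∫ f^p dν)^(1/p) for all measurable f ≥ 0,
then D_α(μ‖ν) ≤ αt/(α-1) (`renyiDiv_le_of_forall_lintegral_le`). Inequalities of this dual form
compose along Markov chains: the factors e^t multiply, and concavity of x ↦ x^(1/p) moves averages
inside the power.

The noise of each step is split into two independent Gaussians of half the variance. One half hides
the data point i that differs. A uniform batch is a batch R avoiding i with probability 1 - q, q =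
b/n, and R with one element swapped for i with probability q. Both chains agree on R, so two
Gaussian mixtures with a common main component are compared (`gaussAvg_mixture_le`). In the moments
of the likelihood ratio the linear term has mean zero, so the cost is of order (α-1)q² times the
squared ratio of sensitivity to noise, that is (α-1)L²/(n²σ²); the condition on α controls the
tails. The other half absorbs a shift of size Δ = Lη/n by the Cameron-Martin formula, at a cost of
the same order.

Since gradient steps and the projection are nonexpansive, two chains started at distance at most kΔ
can be compared after k steps by absorbing Δ in each of them (`iterate_chainOp_le`). With k = T and
equal starting points this gives the factor T. If T ≥ T̄, it is applied to the last T̄ steps only: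
T̄Δ ≥ D, so any two points of K may serve as starting points and the earlier steps do not matter
(`lintegral_sgdLaw_le`).

The losses live on K only, which may have empty interior. Hence gradients are replaced by their
components along the affine span of K, which alone affect the projected step; Lipschitz and
co-coercivity bounds are obtained at relative interior points and extended to K by a limit. -/

namespace NoisySGD

/-! ### Translation, marginals and splitting of the standard Gaussian. -/

section Gaussian

variable {E : Type*} [NormedAddCommGroup E] [InnerProductSpace ℝ E]

/-- The density of the translate of the standard Gaussian by `v`. -/
noncomputable def shiftDensity (v x : E) : ℝ := Real.exp (inner ℝ v x - ‖v‖ ^ 2 / 2)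

lemma continuous_shiftDensity (v : E) : Continuous (shiftDensity v) := by
  unfold shiftDensity; fun_prop

lemma shiftDensity_pos (v x : E) : 0 < shiftDensity v x := Real.exp_pos _

variable [FiniteDimensional ℝ E] [MeasurableSpace E] [BorelSpace E]

/-- The complex Laplace transform of the standard Gaussian at `v + i t`. -/
lemma integral_cexp_inner_stdGaussian (v t : E) :
    ∫ x, Complex.exp (inner ℝ v x + inner ℝ x t * Complex.I) ∂(stdGaussian E) =
      Complex.exp (‖v‖ ^ 2 / 2 + inner ℝ v t * Complex.I - ‖t‖ ^ 2 / 2) := by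
  have hb : ∀ x : Fin (Module.finrank ℝ E) → ℝ,
      Complex.exp (inner ℝ v (∑ i, x i • stdOrthonormalBasis ℝ E i) +
        inner ℝ (∑ i, x i • stdOrthonormalBasis ℝ E i) t * Complex.I) =
      ∏ i, Complex.exp (((inner ℝ (stdOrthonormalBasis ℝ E i) v : ℝ) +
        (inner ℝ (stdOrthonormalBasis ℝ E i) t : ℝ) * Complex.I) * (x i : ℂ)) := by
    intro x
    rw [← Complex.exp_sum, inner_sum, sum_inner]
    congr 1
    push_cast
    rw [Finset.sum_mul, ← Finset.sum_add_distrib]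
    refine Finset.sum_congr rfl fun i _ => ?_
    rw [real_inner_smul_left, real_inner_smul_right, real_inner_comm v]
    push_cast
    ring
  rw [stdGaussian, integral_map (Measurable.aemeasurable (by fun_prop))
    (Measurable.aestronglyMeasurable (by fun_prop))]
  simp_rw [hb]
  rw [integral_fintype_prod_eq_prod (f := fun i (x : ℝ) ↦
    Complex.exp (((inner ℝ (stdOrthonormalBasis ℝ E i) v : ℝ) +
        (inner ℝ (stdOrthonormalBasis ℝ E i) t : ℝ) * Complex.I) * (x : ℂ)))]
  have h1 : ∀ z : ℂ, ∫ x : ℝ, Complex.exp (z * x) ∂(gaussianReal 0 1) =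
      Complex.exp (z ^ 2 / 2) := by
    intro z
    have := complexMGF_id_gaussianReal (μ := 0) (v := 1) z
    simpa [complexMGF] using this
  simp_rw [h1]
  rw [← Complex.exp_sum]
  congr 1
  have hv := (stdOrthonormalBasis ℝ E).sum_sq_inner_right v
  have ht := (stdOrthonormalBasis ℝ E).sum_sq_inner_right t
  have hvt := (stdOrthonormalBasis ℝ E).sum_inner_mul_inner v t
  rw [← Complex.ofReal_pow, ← Complex.ofReal_pow, ← hv, ← ht, ← hvt]
  push_cast
  rw [Finset.sum_div, Finset.sum_div, Finset.sum_mul, ← Finset.sum_add_distrib,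
    ← Finset.sum_sub_distrib]
  refine Finset.sum_congr rfl fun i _ => ?_
  rw [real_inner_comm v]
  linear_combination ((inner ℝ (stdOrthonormalBasis ℝ E i) t : ℝ) : ℂ) ^ 2 / 2 * Complex.I_sq

lemma integrable_shiftDensity (v : E) : Integrable (shiftDensity v) (stdGaussian E) := by
  have h := integral_cexp_inner_stdGaussian v (0 : E)
  have h2 : Integrable (fun x => Complex.exp (inner ℝ v x + inner ℝ x (0 : E) * Complex.I))
      (stdGaussian E) := by
    -- The integral computed in `h` is nonzero, whereas the Bochner integral of a non-integrable
    -- function is 0 by convention.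
    by_contra hc
    rw [integral_undef hc] at h
    exact Complex.exp_ne_zero _ h.symm
  have h3 := h2.norm.mul_const (Real.exp (- (‖v‖ ^ 2 / 2)))
  refine h3.congr (Filter.Eventually.of_forall fun x => ?_)
  simp [Complex.norm_exp, shiftDensity, ← Real.exp_add, sub_eq_add_neg]

/-- Cameron-Martin formula for the standard Gaussian. -/
lemma map_add_stdGaussian (v : E) :
    (stdGaussian E).map (fun x => v + x) =
      (stdGaussian E).withDensity (fun x => ENNReal.ofReal (shiftDensity v x)) := by
  have : IsFiniteMeasure ((stdGaussian E).withDensity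
      (fun x => ENNReal.ofReal (shiftDensity v x))) :=
    isFiniteMeasure_withDensity_ofReal (integrable_shiftDensity v).2
  have : IsProbabilityMeasure ((stdGaussian E).map (fun x => v + x)) :=
    Measure.isProbabilityMeasure_map (by fun_prop)
  apply Measure.ext_of_charFun
  ext t
  rw [charFun_apply, charFun_apply, integral_map (by fun_prop)
    (Measurable.aestronglyMeasurable (by fun_prop))]
  have h1 : ∀ x : E, Complex.exp (inner ℝ (v + x) t * Complex.I) =
      Complex.exp (inner ℝ v t * Complex.I) * Complex.exp (inner ℝ x t * Complex.I) := by
    intro x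
    rw [← Complex.exp_add, inner_add_left]; push_cast; ring_nf
  simp_rw [h1]
  rw [integral_const_mul, ← charFun_apply, charFun_stdGaussian]
  have hm : Measurable (fun x => (shiftDensity v x).toNNReal) :=
    (continuous_shiftDensity v).measurable.real_toNNReal
  have h2 := integral_withDensity_eq_integral_smul (μ := stdGaussian E) hm
    (fun x : E => Complex.exp (inner ℝ x t * Complex.I))
  change _ = ∫ x, Complex.exp (inner ℝ x t * Complex.I) ∂((stdGaussian E).withDensity
    (fun x => ((shiftDensity v x).toNNReal : ℝ≥0∞)))
  rw [h2]
  have h3 : ∀ x : E, (shiftDensity v x).toNNReal • Complex.exp (inner ℝ x t * Complex.I) =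
      Complex.exp (-(‖v‖ ^ 2 / 2)) *
        Complex.exp (inner ℝ v x + inner ℝ x t * Complex.I) := by
    intro x
    rw [NNReal.smul_def, Real.coe_toNNReal _ (shiftDensity_pos v x).le, Complex.real_smul,
      shiftDensity, Complex.ofReal_exp, ← Complex.exp_add, ← Complex.exp_add]
    push_cast
    ring_nf
  simp_rw [h3]
  rw [integral_const_mul, integral_cexp_inner_stdGaussian, ← Complex.exp_add, ← Complex.exp_add]
  congr 1
  ring

lemma lintegral_add_stdGaussian (v : E) {F : E → ℝ≥0∞} (hF : Measurable F) :
    ∫⁻ x, F (v + x) ∂(stdGaussian E) =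
      ∫⁻ x, F x * ENNReal.ofReal (shiftDensity v x) ∂(stdGaussian E) := by
  rw [← lintegral_map hF (by fun_prop), map_add_stdGaussian,
    lintegral_withDensity_eq_lintegral_mul _
      (continuous_shiftDensity v).measurable.ennreal_ofReal hF]
  simp [mul_comm]

lemma map_inner_stdGaussian (v : E) :
    (stdGaussian E).map (fun x => inner ℝ v x) = (gaussianReal 0 1).map (fun y => ‖v‖ * y) := by
  have h := IsGaussian.map_eq_gaussianReal (μ := stdGaussian E) (innerSL ℝ v)
  rw [integral_strongDual_stdGaussian, variance_dual_stdGaussian] at h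
  rw [gaussianReal_map_const_mul]
  simp only [innerSL_apply_norm, mul_zero, mul_one] at h ⊢
  convert h using 2
  · ext
    simp
  · exact (Real.toNNReal_of_nonneg (sq_nonneg _)).symm

lemma lintegral_inner_stdGaussian (v : E) {F : ℝ → ℝ≥0∞} (hF : Measurable F) :
    ∫⁻ x, F (inner ℝ v x) ∂(stdGaussian E) = ∫⁻ y, F (‖v‖ * y) ∂(gaussianReal 0 1) := by
  rw [← lintegral_map hF (by fun_prop), map_inner_stdGaussian, lintegral_map hF (by fun_prop)]

/-- Splits the noise into two independent halves: one is spent on privacy, the other on absorbing a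
shift. -/
lemma stdGaussian_eq_conv :
    stdGaussian E = ((stdGaussian E).map (fun x => (√2)⁻¹ • x)) ∗
      ((stdGaussian E).map (fun x => (√2)⁻¹ • x)) := by
  have : IsProbabilityMeasure ((stdGaussian E).map (fun x => (√2)⁻¹ • x)) :=
    Measure.isProbabilityMeasure_map (by fun_prop)
  apply Measure.ext_of_charFun
  ext t
  rw [charFun_conv, charFun_map_smul, charFun_stdGaussian, charFun_stdGaussian, ← Complex.exp_add,
    norm_smul]
  congr 1
  have : ((‖(√2)⁻¹‖ * ‖t‖ : ℝ) : ℂ) ^ 2 = (‖t‖ : ℂ) ^ 2 / 2 := by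
    rw [← Complex.ofReal_pow, mul_pow]
    norm_num
    ring
  rw [this]
  ring

lemma lintegral_stdGaussian_split {F : E → ℝ≥0∞} (hF : Measurable F) :
    ∫⁻ x, F x ∂(stdGaussian E) =
      ∫⁻ x, ∫⁻ y, F ((√2)⁻¹ • x + (√2)⁻¹ • y) ∂(stdGaussian E) ∂(stdGaussian E) := by
  have : IsProbabilityMeasure ((stdGaussian E).map (fun x => (√2)⁻¹ • x)) :=
    Measure.isProbabilityMeasure_map (by fun_prop)
  conv_lhs => rw [stdGaussian_eq_conv]
  rw [Measure.lintegral_conv hF, lintegral_map _ (by fun_prop)]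
  · refine lintegral_congr fun x => ?_
    rw [lintegral_map (by fun_prop) (by fun_prop)]
  · exact Measurable.lintegral_prod_right' (f := fun p : E × E => F (p.1 + p.2)) (by fun_prop)

/-- This function dominates all second order remainders below; it is integrable because 1/4 < 1/2.
-/
lemma integrable_exp_sq_gaussianReal :
    Integrable (fun x : ℝ => Real.exp (x ^ 2 / 4)) (gaussianReal 0 1) := by
  rw [gaussianReal_of_var_ne_zero _ one_ne_zero,
    integrable_withDensity_iff_integrable_smul' (measurable_gaussianPDF 0 1)
      (Filter.Eventually.of_forall fun x => gaussianPDF_lt_top)]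
  have h := (integrable_exp_neg_mul_sq (b := 1 / 4) (by norm_num)).const_mul ((√(2 * Real.pi))⁻¹)
  refine h.congr (Filter.Eventually.of_forall fun x => ?_)
  simp only [toReal_gaussianPDF, gaussianPDFReal, smul_eq_mul, NNReal.coe_one, mul_one]
  rw [mul_assoc, ← Real.exp_add]
  ring_nf

end Gaussian

/-! ### Moments of the likelihood ratio of the sampled Gaussian mechanism, in one dimension. -/

section Scalar

/-- A second order Taylor bound for `y ↦ y ^ α` at `1`. -/
lemma rpow_le_one_add_quadratic {α y c : ℝ} (hα : 1 < α) (hy : 1 / 2 ≤ y) (hc : 1 ≤ c)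
    (hyc : 1 ≤ y → y ^ α ≤ c) :
    y ^ α ≤ 1 + α * (y - 1) + 2 * (α * (α - 1)) * (y - 1) ^ 2 * c := by
  have hy0 : 0 < y := by linarith
  -- The convex power lies above its tangent at `y`, evaluated at 1; this is Bernoulli's inequality
  -- for `y⁻¹`.
  have htan : y ^ α ≤ 1 + α * (y - 1) * y ^ (α - 1) := by
    have hB := one_add_mul_self_le_rpow_one_add (s := y⁻¹ - 1) (by
      have := inv_pos.2 hy0; linarith) hα.le
    have h1 : (1 + (y⁻¹ - 1)) ^ α = (y ^ α)⁻¹ := by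
      rw [add_sub_cancel, Real.inv_rpow hy0.le]
    rw [h1] at hB
    have hp : 0 < y ^ α := Real.rpow_pos_of_pos hy0 _
    have h2 := mul_le_mul_of_nonneg_right hB hp.le
    rw [inv_mul_cancel₀ hp.ne'] at h2
    have h3 : y ^ α = y ^ (α - 1) * y := by
      rw [← Real.rpow_add_one hy0.ne']; ring_nf
    have h4 : y⁻¹ * y ^ α = y ^ (α - 1) := by
      rw [h3]; field_simp
    nlinarith
  have key : (y - 1) * (y ^ (α - 1) - 1) ≤ 2 * (α - 1) * (y - 1) ^ 2 * c := by
    rw [Real.rpow_def_of_pos hy0]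
    rcases le_total 1 y with h | h
    · set u := Real.log y * (α - 1) with hu
      have hl : Real.log y ≤ y - 1 := Real.log_le_sub_one_of_pos hy0
      have hl0 : 0 ≤ Real.log y := Real.log_nonneg h
      have hu0 : 0 ≤ u := mul_nonneg hl0 (by linarith)
      have h1 : Real.exp u ≤ c := by
        refine le_trans ?_ (hyc h)
        rw [Real.rpow_def_of_pos hy0]
        apply Real.exp_le_exp.2
        rw [hu]; nlinarith
      have h2 : Real.exp u - 1 ≤ u * Real.exp u := by
        have h3 := Real.add_one_le_exp (-u)
        have h4 : Real.exp (-u) * Real.exp u = 1 := by rw [← Real.exp_add]; simp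
        nlinarith [Real.exp_pos u]
      have h5 : u * Real.exp u ≤ (y - 1) * (α - 1) * c := by
        apply mul_le_mul _ h1 (Real.exp_pos u).le (by nlinarith)
        rw [hu]; nlinarith
      have h6 := mul_le_mul_of_nonneg_left (h2.trans h5) (by linarith : 0 ≤ y - 1)
      have h7 : 0 ≤ (α - 1) * (y - 1) ^ 2 * c := by
        have : 0 ≤ α - 1 := by linarith
        positivity
      nlinarith
    · have hl : 1 - y⁻¹ ≤ Real.log y := Real.one_sub_inv_le_log_of_pos hy0
      have hi : y⁻¹ - 1 ≤ 2 * (1 - y) := by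
        rw [inv_eq_one_div, div_sub_one hy0.ne', div_le_iff₀ hy0]; nlinarith
      have h1 := Real.add_one_le_exp (Real.log y * (α - 1))
      have h2 : 2 * (y - 1) * (α - 1) ≤ Real.log y * (α - 1) := by nlinarith
      have h3 : (y - 1) * (Real.exp (Real.log y * (α - 1)) - 1) ≤
          (y - 1) * (2 * (y - 1) * (α - 1)) :=
        mul_le_mul_of_nonpos_left (by linarith) (by linarith)
      have h4 : 0 ≤ (α - 1) * (y - 1) ^ 2 := by
        have : 0 ≤ α - 1 := by linarith
        positivity
      nlinarith
  nlinarith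

/-- A second order Taylor bound for `y ↦ y ^ (1 - α)` at `1`. -/
lemma rpow_one_sub_le_one_add_quadratic {α y c : ℝ} (hα : 1 < α) (hy : 1 / 2 ≤ y) (hc : 1 ≤ c)
    (hyc : y ≤ 1 → y ^ (-α) ≤ c) :
    y ^ (1 - α) ≤ 1 - (α - 1) * (y - 1) + 2 * (α * (α - 1)) * (y - 1) ^ 2 * c := by
  have hy0 : 0 < y := by linarith
  have htan : y ^ (1 - α) ≤ 1 - (α - 1) * (y - 1) * y ^ (-α) := by
    have hB := one_add_mul_self_le_rpow_one_add (s := y - 1) (by linarith) hα.le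
    rw [add_sub_cancel] at hB
    have hp : 0 < y ^ (-α) := Real.rpow_pos_of_pos hy0 _
    have h2 := mul_le_mul_of_nonneg_right hB hp.le
    rw [← Real.rpow_add hy0, add_neg_cancel, Real.rpow_zero] at h2
    have h3 : y ^ (1 - α) = y ^ (-α) * y := by
      rw [← Real.rpow_add_one hy0.ne']; ring_nf
    rw [h3]
    nlinarith
  have key : -(y - 1) * (y ^ (-α) - 1) ≤ 2 * α * (y - 1) ^ 2 * c := by
    rw [Real.rpow_def_of_pos hy0] at hyc ⊢
    set u := Real.log y * (-α) with hu
    have h4 : 0 ≤ α * (y - 1) ^ 2 := by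
      have : 0 ≤ α := by linarith
      positivity
    rcases le_total 1 y with h | h
    · have hl : Real.log y ≤ y - 1 := Real.log_le_sub_one_of_pos hy0
      have h1 := Real.add_one_le_exp u
      have h2 : - (α * (y - 1)) ≤ u := by rw [hu]; nlinarith
      have h3 : (y - 1) * (- (α * (y - 1))) ≤ (y - 1) * (Real.exp u - 1) :=
        mul_le_mul_of_nonneg_left (by linarith) (by linarith)
      nlinarith
    · have hl : 1 - y⁻¹ ≤ Real.log y := Real.one_sub_inv_le_log_of_pos hy0
      have hl0 : Real.log y ≤ 0 := Real.log_nonpos hy0.le h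
      have hi : y⁻¹ - 1 ≤ 2 * (1 - y) := by
        rw [inv_eq_one_div, div_sub_one hy0.ne', div_le_iff₀ hy0]; nlinarith
      have hu0 : 0 ≤ u := by rw [hu]; nlinarith
      have hu1 : u ≤ 2 * (1 - y) * α := by rw [hu]; nlinarith
      have h2 : Real.exp u - 1 ≤ u * Real.exp u := by
        have h3 := Real.add_one_le_exp (-u)
        have h4 : Real.exp (-u) * Real.exp u = 1 := by rw [← Real.exp_add]; simp
        nlinarith [Real.exp_pos u]
      have h5 : u * Real.exp u ≤ 2 * (1 - y) * α * c :=
        mul_le_mul hu1 (hyc h) (Real.exp_pos u).le (by nlinarith)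
      have h6 := mul_le_mul_of_nonneg_left (h2.trans h5) (by linarith : 0 ≤ 1 - y)
      nlinarith
  have h8 : 0 ≤ α - 1 := by linarith
  have h9 := mul_le_mul_of_nonneg_left key h8
  nlinarith

/-- Growth bound for the likelihood ratio of the sampled Gaussian mechanism, to the right of the
mode. -/
lemma mixture_rpow_le {α q τ Y G : ℝ} (hα : 1 < α) (hq : 0 < q) (hq4 : q ≤ 1 / 4)
    (hτ0 : 0 ≤ τ) (hτ : τ ≤ 1 / 4)
    (hατ : α * τ ^ 2 ≤ Real.log (1 + 1 / (q * (α - 1))) / 2) (hY : 0 ≤ Y) (hYG : Y ≤ τ * |G|) :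
    (1 + 2 * q * (Real.exp Y - 1)) ^ α ≤ Real.exp (4 + G ^ 2 / 8) := by
  have hG : 0 ≤ |G| := abs_nonneg G
  have hGs : |G| ^ 2 = G ^ 2 := sq_abs G
  have hE : 1 ≤ Real.exp Y := Real.one_le_exp hY
  have hb0 : 0 < 1 + 2 * q * (Real.exp Y - 1) := by nlinarith
  -- Small `α` is separate because the bound 2α/(α-1) ≤ 4 used below needs α ≥ 2.
  rcases le_total α 2 with h2 | h2
  · have h1 : (1 + 2 * q * (Real.exp Y - 1)) ^ α ≤ (Real.exp Y) ^ α :=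
      Real.rpow_le_rpow hb0.le (by nlinarith) (by linarith)
    refine h1.trans ?_
    rw [← Real.exp_mul]
    apply Real.exp_le_exp.2
    nlinarith [sq_nonneg (|G| - 2), mul_le_mul hYG h2 (by linarith) (by positivity)]
  -- `Λ` is the point where 2qα(e^Z - 1) reaches 2α/(α-1): up to `Λ` the power stays below e^4, and
  -- beyond it grows at most like e^(α(Y-Λ)).
  set Λ := Real.log (1 + 1 / (q * (α - 1))) with hΛ
  have hr : 0 < q * (α - 1) := mul_pos hq (by linarith)
  have hΛexp : Real.exp Λ = 1 + 1 / (q * (α - 1)) := Real.exp_log (by positivity)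
  have hΛ0 : 0 ≤ Λ := Real.log_nonneg (by
    have : 0 ≤ 1 / (q * (α - 1)) := by positivity
    linarith)
  have hΛb : ∀ Z, Z ≤ Λ → 0 ≤ Z → (1 + 2 * q * (Real.exp Z - 1)) ^ α ≤ Real.exp 4 := by
    intro Z hZ hZ0
    have hE' : 1 ≤ Real.exp Z := Real.one_le_exp hZ0
    have h3 : 1 + 2 * q * (Real.exp Z - 1) ≤ Real.exp (2 * q * (Real.exp Z - 1)) := by
      linarith [Real.add_one_le_exp (2 * q * (Real.exp Z - 1))]
    refine (Real.rpow_le_rpow (by nlinarith) h3 (by linarith)).trans ?_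
    rw [← Real.exp_mul]
    apply Real.exp_le_exp.2
    have h4 : Real.exp Z - 1 ≤ 1 / (q * (α - 1)) := by
      have := Real.exp_le_exp.2 hZ
      linarith
    rw [le_div_iff₀ hr] at h4
    nlinarith
  rcases le_total Y Λ with hYΛ | hYΛ
  · refine (hΛb Y hYΛ hY).trans (Real.exp_le_exp.2 ?_)
    nlinarith
  · have h3 : 1 + 2 * q * (Real.exp Y - 1) ≤
        Real.exp (Y - Λ) * (1 + 2 * q * (Real.exp Λ - 1)) := by
      have h4 : Real.exp Y = Real.exp (Y - Λ) * Real.exp Λ := by rw [← Real.exp_add]; ring_nf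
      have h5 : 1 ≤ Real.exp (Y - Λ) := Real.one_le_exp (by linarith)
      rw [h4]
      nlinarith
    have hbΛ : 0 ≤ 1 + 2 * q * (Real.exp Λ - 1) := by
      have := Real.one_le_exp hΛ0
      nlinarith
    refine (Real.rpow_le_rpow hb0.le h3 (by linarith)).trans ?_
    rw [Real.mul_rpow (Real.exp_pos _).le hbΛ, ← Real.exp_mul, add_comm (4 : ℝ), Real.exp_add]
    refine mul_le_mul (Real.exp_le_exp.2 ?_) (hΛb Λ le_rfl hΛ0) (by positivity)
      (Real.exp_pos _).le
    rcases hYΛ.eq_or_lt with h | h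
    · rw [h]; simp; positivity
    have hτp : 0 < τ := by
      rcases hτ0.eq_or_lt with h' | h'
      · rw [← h'] at hYG; linarith
      · exact h'
    -- By `hατ` the left side is at most (Y-Λ)Λ/2 ≤ Y²/8, where the last inequality is (Y-2Λ)² ≥ 0.
    have h6 : τ ^ 2 * ((Y - Λ) * α) ≤ τ ^ 2 * (G ^ 2 / 8) := by
      have h7 : Y ^ 2 ≤ τ ^ 2 * G ^ 2 := by rw [← hGs, ← mul_pow]; gcongr
      nlinarith [sq_nonneg (Y - 2 * Λ)]
    exact le_of_mul_le_mul_left h6 (by positivity)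

/-- Growth bound for the inverse likelihood ratio of the sampled Gaussian mechanism, to the left of
the mode. -/
lemma mixture_rpow_neg_le {α q τ Y G : ℝ} (hα : 1 < α) (hq : 0 < q) (hq4 : q ≤ 1 / 4)
    (hτ0 : 0 ≤ τ) (hτ : τ ≤ 1 / 4)
    (hατ : α * τ ^ 2 ≤ Real.log (1 + 1 / (q * (α - 1))) / 2)
    (hYG : -Y ≤ τ * (|G| + 1)) :
    (1 + 2 * q * (Real.exp Y - 1)) ^ (-α) ≤ Real.exp (4 + G ^ 2 / 8) := by
  have hG : 0 ≤ |G| := abs_nonneg G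
  have hGs : |G| ^ 2 = G ^ 2 := sq_abs G
  have hr : 0 < q * (α - 1) := mul_pos hq (by linarith)
  -- Convexity of exp bounds the negative power by e^(-2qαY); it then suffices that 2qατ ≤ 1, which
  -- for large `α` follows from `hατ` and log(1+x) ≤ x.
  have hconv : Real.exp (2 * q * Y) ≤ 1 + 2 * q * (Real.exp Y - 1) := by
    have := convexOn_exp.2 (Set.mem_univ Y) (Set.mem_univ 0) (by linarith : 0 ≤ 2 * q)
      (by linarith : 0 ≤ 1 - 2 * q) (by ring)
    simp only [smul_eq_mul, mul_zero, add_zero, Real.exp_zero, mul_one] at this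
    linarith
  refine (Real.rpow_le_rpow_of_nonpos (Real.exp_pos _) hconv (by linarith)).trans ?_
  rw [← Real.exp_mul]
  apply Real.exp_le_exp.2
  have hατ' : α * τ ^ 2 * (q * (α - 1)) ≤ 1 / 2 := by
    have h1 : Real.log (1 + 1 / (q * (α - 1))) ≤ 1 / (q * (α - 1)) := by
      have := Real.log_le_sub_one_of_pos (x := 1 + 1 / (q * (α - 1))) (by positivity)
      linarith
    have h2 : α * τ ^ 2 ≤ 1 / (q * (α - 1)) / 2 := by linarith
    calc α * τ ^ 2 * (q * (α - 1)) ≤ 1 / (q * (α - 1)) / 2 * (q * (α - 1)) := by gcongr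
      _ = 1 / 2 := by rw [div_mul_eq_mul_div, one_div_mul_cancel hr.ne']
  have hs : 2 * q * α * τ ≤ 1 := by
    rcases le_total α 2 with h2 | h2
    · have : q * τ ≤ 1 / 4 * (1 / 4) := mul_le_mul hq4 hτ hτ0 (by norm_num)
      have h3 : α * (q * τ) ≤ 2 * (1 / 4 * (1 / 4)) :=
        mul_le_mul h2 this (by positivity) (by norm_num)
      linarith
    · have h3 : (2 * q * α * τ) ^ 2 ≤ 1 := by
        have h4 : (2 * q * α * τ) ^ 2 = 4 * q * (α * τ ^ 2 * (q * α)) := by ring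
        have h5 : α * τ ^ 2 * (q * α) ≤ 2 * (α * τ ^ 2 * (q * (α - 1))) := by
          have : 0 ≤ α * τ ^ 2 * q * (α - 2) := by
            have : 0 ≤ α - 2 := by linarith
            positivity
          nlinarith
        rw [h4]
        nlinarith
      nlinarith
  have h6 : 2 * q * α * (-Y) ≤ |G| + 1 := by
    have h7 : 2 * q * α * (-Y) ≤ 2 * q * α * (τ * (|G| + 1)) := by gcongr
    nlinarith
  nlinarith [sq_nonneg (|G| - 4)]

/-- Extracts the factor τ² from the remainder and leaves an integrable Gaussian weight. The 10 is
what remains after completing the square (|G|-6)². -/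
lemma sq_exp_sub_one_le {τ Y G : ℝ} (hτ0 : 0 ≤ τ) (hτ : τ ≤ 1 / 4)
    (hYG : |Y| ≤ τ * (|G| + 1)) :
    (Real.exp Y - 1) ^ 2 * Real.exp (4 + G ^ 2 / 8) ≤
      2 * Real.exp 10 * τ ^ 2 * Real.exp (G ^ 2 / 4) := by
  have hG : 0 ≤ |G| := abs_nonneg G
  have hGs : |G| ^ 2 = G ^ 2 := sq_abs G
  have h1 : |Real.exp Y - 1| ≤ |Y| * Real.exp |Y| := by
    have h3 : ∀ u : ℝ, Real.exp u - 1 ≤ u * Real.exp u := by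
      intro u
      have h3 := Real.add_one_le_exp (-u)
      have h4 : Real.exp (-u) * Real.exp u = 1 := by rw [← Real.exp_add]; simp
      nlinarith [Real.exp_pos u]
    rcases le_total 0 Y with h | h
    · rw [abs_of_nonneg h, abs_of_nonneg (by linarith [Real.one_le_exp h])]
      exact h3 Y
    · rw [abs_of_nonpos h, abs_of_nonpos (by linarith [Real.exp_le_one_iff.2 h])]
      have := Real.add_one_le_exp Y
      have h5 := Real.one_le_exp (by linarith : 0 ≤ -Y)
      nlinarith
  have h2 : |Real.exp Y - 1| ≤ τ * (|G| + 1) * Real.exp ((|G| + 1) / 4) := by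
    refine h1.trans (mul_le_mul hYG (Real.exp_le_exp.2 ?_) (Real.exp_pos _).le (by positivity))
    nlinarith
  have h3 : (Real.exp Y - 1) ^ 2 ≤ τ ^ 2 * (|G| + 1) ^ 2 * Real.exp ((|G| + 1) / 2) := by
    rw [← sq_abs]
    refine (pow_le_pow_left₀ (abs_nonneg _) h2 2).trans_eq ?_
    rw [mul_pow, mul_pow, ← Real.exp_nat_mul]
    congr 2
    push_cast; ring
  have h4 : (|G| + 1) ^ 2 ≤ 2 * Real.exp (|G| + 1) := by
    have := Real.quadratic_le_exp_of_nonneg (x := |G| + 1) (by positivity)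
    nlinarith
  calc (Real.exp Y - 1) ^ 2 * Real.exp (4 + G ^ 2 / 8)
      ≤ τ ^ 2 * (2 * Real.exp (|G| + 1)) * Real.exp ((|G| + 1) / 2) *
          Real.exp (4 + G ^ 2 / 8) := by
        refine mul_le_mul_of_nonneg_right (h3.trans ?_) (Real.exp_pos _).le
        gcongr
    _ = 2 * τ ^ 2 * Real.exp ((|G| + 1) + (|G| + 1) / 2 + (4 + G ^ 2 / 8)) := by
        rw [Real.exp_add (|G| + 1 + (|G| + 1) / 2), Real.exp_add (|G| + 1) ((|G| + 1) / 2)]; ring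
    _ ≤ 2 * τ ^ 2 * Real.exp (10 + G ^ 2 / 4) := by
        refine mul_le_mul_of_nonneg_left (Real.exp_le_exp.2 ?_) (by positivity)
        nlinarith [sq_nonneg (|G| - 6)]
    _ = _ := by rw [Real.exp_add]; ring

/-- The universal constant in the bound on the Rényi moments of the sampled Gaussian mechanism. -/
noncomputable def momentConst : ℝ :=
  16 * Real.exp 10 * ∫ x, Real.exp (x ^ 2 / 4) ∂(gaussianReal 0 1)

lemma momentConst_nonneg : 0 ≤ momentConst :=
  mul_nonneg (by positivity) (integral_nonneg fun _ => (Real.exp_pos _).le)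

lemma integral_exp_mul_sub_gaussianReal (τ : ℝ) :
    Integrable (fun y => Real.exp (τ * y - τ ^ 2 / 2)) (gaussianReal 0 1) ∧
      ∫ y, Real.exp (τ * y - τ ^ 2 / 2) ∂(gaussianReal 0 1) = 1 := by
  have h : (fun y => Real.exp (τ * y - τ ^ 2 / 2)) =
      fun y => Real.exp (τ * y) * Real.exp (- (τ ^ 2 / 2)) := by
    ext y; rw [← Real.exp_add]; ring_nf
  rw [h]
  refine ⟨(integrable_exp_mul_gaussianReal τ).mul_const _, ?_⟩
  rw [integral_mul_const]
  have := congrFun (mgf_id_gaussianReal (μ := 0) (v := 1)) τ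
  simp only [mgf, id] at this
  rw [this, ← Real.exp_add]
  simp

/-- The likelihood ratio has mean 1, so the linear term integrates to zero and only the remainder of
order q²τ² survives. This is the gain from sampling. -/
lemma lintegral_le_of_le_quadratic {α q τ c : ℝ} {F : ℝ → ℝ}
    (hF : ∀ y, F y ≤ 1 + c * (2 * q * (Real.exp (τ * y - τ ^ 2 / 2) - 1)) +
      16 * Real.exp 10 * (α * (α - 1)) * q ^ 2 * τ ^ 2 * Real.exp (y ^ 2 / 4))
    (hF0 : ∀ y, 0 ≤ F y) :
    ∫⁻ y, ENNReal.ofReal (F y) ∂(gaussianReal 0 1) ≤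
      ENNReal.ofReal (Real.exp (momentConst * (α * (α - 1)) * q ^ 2 * τ ^ 2)) := by
  obtain ⟨hi, he⟩ := integral_exp_mul_sub_gaussianReal τ
  have hi2 := integrable_exp_sq_gaussianReal
  have hsub : Integrable (fun y => Real.exp (τ * y - τ ^ 2 / 2) - 1) (gaussianReal 0 1) :=
    hi.sub (integrable_const _)
  have hi1 : Integrable (fun y => 1 + c * (2 * q * (Real.exp (τ * y - τ ^ 2 / 2) - 1)))
      (gaussianReal 0 1) :=
    (integrable_const _).add ((hsub.const_mul _).const_mul _)
  have hi3 := hi2.const_mul (16 * Real.exp 10 * (α * (α - 1)) * q ^ 2 * τ ^ 2)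
  have hval : ∫ y, (1 + c * (2 * q * (Real.exp (τ * y - τ ^ 2 / 2) - 1)) +
      16 * Real.exp 10 * (α * (α - 1)) * q ^ 2 * τ ^ 2 * Real.exp (y ^ 2 / 4))
        ∂(gaussianReal 0 1) = momentConst * (α * (α - 1)) * q ^ 2 * τ ^ 2 + 1 := by
    rw [integral_add hi1 hi3, integral_const_mul, integral_add (integrable_const _)
      ((hsub.const_mul _).const_mul _), integral_const_mul,
      integral_const_mul, integral_sub hi (integrable_const _), he]
    simp only [integral_const, probReal_univ, smul_eq_mul, mul_one, sub_self, mul_zero,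
      add_zero]
    rw [momentConst]; ring
  refine (lintegral_mono fun y => ENNReal.ofReal_le_ofReal (hF y)).trans ?_
  have h := ofReal_integral_eq_lintegral_ofReal (hi1.add hi3)
    (Filter.Eventually.of_forall fun y => (hF0 y).trans (hF y))
  simp only [Pi.add_apply] at h
  rw [← h, hval]
  exact ENNReal.ofReal_le_ofReal (Real.add_one_le_exp _)

/-- Moment bounds for the likelihood ratio of the sampled Gaussian mechanism. -/
lemma lintegral_mixture_rpow_le {α q τ : ℝ} (hα : 1 < α) (hq : 0 < q) (hq4 : q ≤ 1 / 4)
    (hτ0 : 0 ≤ τ) (hτ : τ ≤ 1 / 4)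
    (hατ : α * τ ^ 2 ≤ Real.log (1 + 1 / (q * (α - 1))) / 2) :
    ∫⁻ y, ENNReal.ofReal ((1 + 2 * q * (Real.exp (τ * y - τ ^ 2 / 2) - 1)) ^ α)
        ∂(gaussianReal 0 1) ≤
      ENNReal.ofReal (Real.exp (momentConst * (α * (α - 1)) * q ^ 2 * τ ^ 2)) ∧
    ∫⁻ y, ENNReal.ofReal ((1 + 2 * q * (Real.exp (τ * y - τ ^ 2 / 2) - 1)) ^ (1 - α))
        ∂(gaussianReal 0 1) ≤
      ENNReal.ofReal (Real.exp (momentConst * (α * (α - 1)) * q ^ 2 * τ ^ 2)) := by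
  -- The weight 2q ≤ 1/2 keeps the ratio away from zero, as the Taylor bounds require.
  have hhalf : ∀ Y : ℝ, 1 / 2 ≤ 1 + 2 * q * (Real.exp Y - 1) := fun Y => by
    nlinarith [Real.exp_pos Y, mul_pos hq (Real.exp_pos Y)]
  have hY : ∀ y : ℝ, |τ * y - τ ^ 2 / 2| ≤ τ * (|y| + 1) := fun y => by
    refine (abs_sub _ _).trans ?_
    rw [abs_mul, abs_of_nonneg hτ0, abs_of_nonneg (by positivity : 0 ≤ τ ^ 2 / 2)]
    nlinarith
  have hc : ∀ y : ℝ, 1 ≤ Real.exp (4 + y ^ 2 / 8) := fun y => Real.one_le_exp (by positivity)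
  have hα1 : 0 < α * (α - 1) := mul_pos (by linarith) (by linarith)
  have hquad : ∀ y : ℝ, 2 * (α * (α - 1)) *
      (1 + 2 * q * (Real.exp (τ * y - τ ^ 2 / 2) - 1) - 1) ^ 2 * Real.exp (4 + y ^ 2 / 8) ≤
      16 * Real.exp 10 * (α * (α - 1)) * q ^ 2 * τ ^ 2 * Real.exp (y ^ 2 / 4) := fun y => by
    have h := sq_exp_sub_one_le hτ0 hτ (hY y)
    have h' := mul_le_mul_of_nonneg_left h (by positivity : 0 ≤ 8 * (α * (α - 1)) * q ^ 2)
    refine le_trans (le_of_eq ?_) (h'.trans (le_of_eq ?_)) <;> ring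
  constructor
  · refine lintegral_le_of_le_quadratic (c := α) (fun y => ?_) (fun y => Real.rpow_nonneg
      (by linarith [hhalf (τ * y - τ ^ 2 / 2)]) _)
    have h := rpow_le_one_add_quadratic hα (hhalf (τ * y - τ ^ 2 / 2)) (hc y) (fun h1 => by
      have hY0 : 0 ≤ τ * y - τ ^ 2 / 2 := by
        by_contra hneg
        push Not at hneg
        have := Real.exp_lt_one_iff.2 hneg
        nlinarith
      refine mixture_rpow_le hα hq hq4 hτ0 hτ hατ hY0 ?_
      nlinarith [le_abs_self y])
    refine h.trans ?_
    have := hquad y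
    linarith
  · refine lintegral_le_of_le_quadratic (c := -(α - 1)) (fun y => ?_) (fun y => Real.rpow_nonneg
      (by linarith [hhalf (τ * y - τ ^ 2 / 2)]) _)
    have h := rpow_one_sub_le_one_add_quadratic hα (hhalf (τ * y - τ ^ 2 / 2)) (hc y)
      (fun h1 => mixture_rpow_neg_le hα hq hq4 hτ0 hτ hατ ((neg_le_abs _).trans (hY y)))
    refine h.trans ?_
    have := hquad y
    linarith

end Scalar

/-! ### Hölder and Jensen inequalities in dual form. -/

section Holder

lemma ofReal_exp_rpow (x y : ℝ) :
    ENNReal.ofReal (Real.exp x) ^ y = ENNReal.ofReal (Real.exp (x * y)) := by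
  rw [ENNReal.ofReal_rpow_of_pos (Real.exp_pos _), Real.exp_mul]

variable {p α : ℝ}

lemma lintegral_mul_ofReal_le {Ω : Type*} [MeasurableSpace Ω] {μ : Measure Ω}
    (hp : p.HolderConjugate α) {F : Ω → ℝ≥0∞} (hF : Measurable F) {ρ : Ω → ℝ} (hρ : Measurable ρ)
    (hρ0 : ∀ x, 0 < ρ x) :
    ∫⁻ x, F x * ENNReal.ofReal (ρ x) ∂μ ≤
      (∫⁻ x, ENNReal.ofReal (ρ x ^ α) ∂μ) ^ (1 / α) * (∫⁻ x, F x ^ p ∂μ) ^ (1 / p) := by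
  refine (ENNReal.lintegral_mul_le_Lp_mul_Lq μ hp hF.aemeasurable
    hρ.ennreal_ofReal.aemeasurable).trans_eq ?_
  rw [mul_comm]
  congr 3
  ext x
  rw [ENNReal.ofReal_rpow_of_pos (hρ0 x)]

/-- Hölder for F = (F ρ^(1/p)) · ρ^(-1/p), with α/p = α - 1. It is the change of measure in the
direction opposite to `lintegral_mul_ofReal_le`. -/
lemma lintegral_le_mul_lintegral_mul_ofReal {Ω : Type*} [MeasurableSpace Ω] {μ : Measure Ω}
    (hp : p.HolderConjugate α) {F : Ω → ℝ≥0∞} (hF : Measurable F) {ρ : Ω → ℝ} (hρ : Measurable ρ)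
    (hρ0 : ∀ x, 0 < ρ x) :
    ∫⁻ x, F x ∂μ ≤ (∫⁻ x, ENNReal.ofReal (ρ x ^ (1 - α)) ∂μ) ^ (1 / α) *
      (∫⁻ x, F x ^ p * ENNReal.ofReal (ρ x) ∂μ) ^ (1 / p) := by
  have h := ENNReal.lintegral_mul_le_Lp_mul_Lq μ hp
    (f := fun x => F x * ENNReal.ofReal (ρ x ^ (1 / p)))
    (g := fun x => ENNReal.ofReal (ρ x ^ (-(1 / p))))
    (hF.mul (hρ.pow_const _).ennreal_ofReal).aemeasurable
    (hρ.pow_const _).ennreal_ofReal.aemeasurable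
  refine le_trans (le_of_eq ?_) (h.trans (le_of_eq ?_))
  · refine lintegral_congr fun x => ?_
    rw [Pi.mul_apply, mul_assoc, ← ENNReal.ofReal_mul (Real.rpow_nonneg (hρ0 x).le _),
      ← Real.rpow_add (hρ0 x)]
    simp
  · rw [mul_comm]
    congr 2
    · refine lintegral_congr fun x => ?_
      rw [ENNReal.ofReal_rpow_of_pos (Real.rpow_pos_of_pos (hρ0 x) _), ← Real.rpow_mul (hρ0 x).le]
      congr 2
      have h1 := hp.symm.sub_one_mul_conj
      have h2 := hp.pos.ne'
      field_simp
      linarith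
    · refine lintegral_congr fun x => ?_
      rw [ENNReal.mul_rpow_of_nonneg _ _ hp.nonneg,
        ENNReal.ofReal_rpow_of_pos (Real.rpow_pos_of_pos (hρ0 x) _), ← Real.rpow_mul (hρ0 x).le,
        one_div_mul_cancel hp.pos.ne', Real.rpow_one]

lemma sum_mul_rpow_le {ι : Type*} (hp : p.HolderConjugate α) (s : Finset ι) (w z : ι → ℝ≥0∞)
    (hw : ∑ i ∈ s, w i = 1) :
    ∑ i ∈ s, w i * z i ^ (1 / p) ≤ (∑ i ∈ s, w i * z i) ^ (1 / p) := by
  have h := ENNReal.rpow_arith_mean_le_arith_mean_rpow s w (fun i => z i ^ (1 / p)) hw hp.lt.le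
  simp_rw [← ENNReal.rpow_mul, one_div_mul_cancel hp.pos.ne', ENNReal.rpow_one] at h
  rw [one_div] at h ⊢
  rwa [ENNReal.le_rpow_inv_iff hp.pos]

lemma half_rpow_add_half_rpow_le (hp : p.HolderConjugate α) (x y : ℝ≥0∞) :
    2⁻¹ * x ^ (1 / p) + 2⁻¹ * y ^ (1 / p) ≤ (2⁻¹ * x + 2⁻¹ * y) ^ (1 / p) := by
  have := sum_mul_rpow_le hp Finset.univ (fun _ : Fin 2 => (2⁻¹ : ℝ≥0∞)) ![x, y]
    (by simp [ENNReal.mul_inv_cancel])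
  simpa using this

/-- Jensen's inequality for `x ↦ x ^ (1 / p)` and a probability measure. -/
lemma lintegral_rpow_le {Ω : Type*} [MeasurableSpace Ω] {μ : Measure Ω} [IsProbabilityMeasure μ]
    (hp : p.HolderConjugate α) {F : Ω → ℝ≥0∞} (hF : Measurable F) :
    ∫⁻ x, F x ^ (1 / p) ∂μ ≤ (∫⁻ x, F x ∂μ) ^ (1 / p) := by
  have h := lintegral_mul_ofReal_le hp (μ := μ) (hF.pow_const (1 / p)) (ρ := fun _ => 1)
    measurable_const (fun _ => one_pos)
  simpa [← ENNReal.rpow_mul, hp.pos.ne'] using h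

end Holder

/-! ### Gaussian averages under shifts and under sampling. -/

section GaussAvg

variable {E : Type*} [NormedAddCommGroup E] [InnerProductSpace ℝ E]

/-- The mixture density `(1 - 2 q) + 2 q dN(v, I)/dN(0, I)`. -/
noncomputable def mixDensity (q : ℝ) (v x : E) : ℝ := 1 + 2 * q * (shiftDensity v x - 1)

lemma mixDensity_pos {q : ℝ} (hq : 0 < q) (hq4 : q ≤ 1 / 4) (v x : E) : 0 < mixDensity q v x := by
  have := mul_pos hq (shiftDensity_pos v x)
  unfold mixDensity
  nlinarith

variable [MeasurableSpace E] [BorelSpace E]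

lemma measurable_mixDensity (q : ℝ) (v : E) : Measurable (mixDensity q v) := by
  have := (continuous_shiftDensity v).measurable
  unfold mixDensity; fun_prop

variable [FiniteDimensional ℝ E]

/-- The average of `F` under `N(m, κ² I)`. -/
noncomputable def gaussAvg (κ : ℝ) (F : E → ℝ≥0∞) (m : E) : ℝ≥0∞ :=
  ∫⁻ x, F (m - κ • x) ∂(stdGaussian E)

lemma measurable_gaussAvg (κ : ℝ) {F : E → ℝ≥0∞} (hF : Measurable F) :
    Measurable (gaussAvg κ F) :=
  Measurable.lintegral_prod_right' (f := fun q : E × E => F (q.1 - κ • q.2))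
    (hF.comp (by fun_prop))

lemma gaussAvg_const_mul (κ : ℝ) (c : ℝ≥0∞) {F : E → ℝ≥0∞} (hF : Measurable F) (m : E) :
    gaussAvg κ (fun x => c * F x) m = c * gaussAvg κ F m :=
  lintegral_const_mul _ (hF.comp (by fun_prop))

lemma gaussAvg_gaussAvg (κ : ℝ) {F : E → ℝ≥0∞} (hF : Measurable F) (m : E) :
    gaussAvg (κ * (√2)⁻¹) (gaussAvg (κ * (√2)⁻¹) F) m = gaussAvg κ F m := by
  unfold gaussAvg
  rw [lintegral_stdGaussian_split (F := fun x => F (m - κ • x)) (hF.comp (by fun_prop))]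
  refine lintegral_congr fun x => lintegral_congr fun y => ?_
  congr 1
  module

lemma gaussAvg_sub_smul (κ : ℝ) {F : E → ℝ≥0∞} (hF : Measurable F) (m v : E) :
    gaussAvg κ F (m - κ • v) =
      ∫⁻ x, F (m - κ • x) * ENNReal.ofReal (shiftDensity v x) ∂(stdGaussian E) := by
  rw [← lintegral_add_stdGaussian v (F := fun x => F (m - κ • x)) (hF.comp (by fun_prop)), gaussAvg]
  refine lintegral_congr fun x => ?_
  congr 1
  module

variable {p α : ℝ}

lemma lintegral_shiftDensity_rpow (v : E) (α : ℝ) :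
    ∫⁻ x, ENNReal.ofReal (shiftDensity v x ^ α) ∂(stdGaussian E) =
      ENNReal.ofReal (Real.exp (α * (α - 1) * ‖v‖ ^ 2 / 2)) := by
  have h : ∀ x, ENNReal.ofReal (shiftDensity v x ^ α) =
      ENNReal.ofReal (Real.exp (α * (α - 1) * ‖v‖ ^ 2 / 2)) *
        ENNReal.ofReal (shiftDensity (α • v) x) := by
    intro x
    rw [← ENNReal.ofReal_mul (Real.exp_pos _).le, shiftDensity, shiftDensity, ← Real.exp_mul,
      ← Real.exp_add, norm_smul, mul_pow, Real.norm_eq_abs, sq_abs, real_inner_smul_left]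
    ring_nf
  simp_rw [h]
  rw [lintegral_const_mul _ (continuous_shiftDensity _).measurable.ennreal_ofReal]
  have h1 := lintegral_add_stdGaussian (α • v) (F := fun _ => 1) measurable_const
  simp only [lintegral_const, measure_univ, mul_one, one_mul] at h1
  rw [← h1, mul_one]

/-- Hölder against the Cameron-Martin density, whose α-th moment is exp(α(α-1)‖v‖²/2); the power 1/α
removes the factor α. -/
lemma gaussAvg_add_le (hp : p.HolderConjugate α) {κ δ : ℝ} (hκ : 0 < κ) {F : E → ℝ≥0∞}
    (hF : Measurable F) (m h : E) (hh : ‖h‖ ≤ δ) :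
    gaussAvg κ F (m + h) ≤ ENNReal.ofReal (Real.exp ((α - 1) * (δ / κ) ^ 2 / 2)) *
      gaussAvg κ (fun x => F x ^ p) m ^ (1 / p) := by
  have hv : m + h = m - κ • (-(κ⁻¹ • h)) := by
    rw [smul_neg, smul_smul, mul_inv_cancel₀ hκ.ne', one_smul, sub_neg_eq_add]
  rw [hv, gaussAvg_sub_smul κ hF]
  refine (lintegral_mul_ofReal_le hp (F := fun x => F (m - κ • x)) (hF.comp (by fun_prop))
    (continuous_shiftDensity _).measurable (shiftDensity_pos _)).trans ?_
  rw [lintegral_shiftDensity_rpow, ofReal_exp_rpow]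
  refine mul_le_mul_left (ENNReal.ofReal_le_ofReal (Real.exp_le_exp.2 ?_)) _
  have h1 : ‖-(κ⁻¹ • h)‖ ≤ δ / κ := by
    rw [norm_neg, norm_smul, norm_inv, Real.norm_of_nonneg hκ.le, inv_mul_eq_div]
    gcongr
  have h2 : ‖-(κ⁻¹ • h)‖ ^ 2 ≤ (δ / κ) ^ 2 := by gcongr
  have h3 := hp.symm.pos
  have h4 := hp.symm.lt
  calc α * (α - 1) * ‖-(κ⁻¹ • h)‖ ^ 2 / 2 * (1 / α) = (α - 1) * ‖-(κ⁻¹ • h)‖ ^ 2 / 2 := by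
        field_simp
    _ ≤ _ := by
        have : 0 ≤ α - 1 := by linarith
        gcongr

lemma lintegral_mul_mixDensity {q : ℝ} (hq : 0 < q) (hq4 : q ≤ 1 / 4) (κ : ℝ) {F : E → ℝ≥0∞}
    (hF : Measurable F) (m v : E) :
    ∫⁻ x, F (m - κ • x) * ENNReal.ofReal (mixDensity q v x) ∂(stdGaussian E) =
      ENNReal.ofReal (1 - 2 * q) * gaussAvg κ F m +
        ENNReal.ofReal (2 * q) * gaussAvg κ F (m - κ • v) := by
  have hs := (continuous_shiftDensity v).measurable
  have hF' : Measurable (fun x => F (m - κ • x)) := hF.comp (by fun_prop)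
  have hFs : Measurable (fun x => F (m - κ • x) * ENNReal.ofReal (shiftDensity v x)) :=
    hF'.mul hs.ennreal_ofReal
  rw [gaussAvg_sub_smul κ hF, gaussAvg, ← lintegral_const_mul _ hF', ← lintegral_const_mul _ hFs, ← lintegral_add_left (hF'.const_mul _)]
  refine lintegral_congr fun x => ?_
  have : mixDensity q v x = (1 - 2 * q) + 2 * q * shiftDensity v x := by unfold mixDensity; ring
  rw [this, ENNReal.ofReal_add (by linarith) (mul_pos (by linarith) (shiftDensity_pos v x)).le,
    ENNReal.ofReal_mul (by linarith)]
  ring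

/-- The density depends on x only through its inner product with v, which is a one-dimensional
Gaussian. -/
lemma lintegral_mixDensity_rpow {q : ℝ} (v : E) (β : ℝ) :
    ∫⁻ x, ENNReal.ofReal (mixDensity q v x ^ β) ∂(stdGaussian E) =
      ∫⁻ y, ENNReal.ofReal ((1 + 2 * q * (Real.exp (‖v‖ * y - ‖v‖ ^ 2 / 2) - 1)) ^ β)
        ∂(gaussianReal 0 1) := by
  rw [← lintegral_inner_stdGaussian v (F := fun y => ENNReal.ofReal
    ((1 + 2 * q * (Real.exp (y - ‖v‖ ^ 2 / 2) - 1)) ^ β)) (by fun_prop)]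
  rfl

/-- Amplification by sampling: comparison of two Gaussian mixtures whose second components, of
weight `q`, are translates of the first one by possibly different vectors. -/
lemma gaussAvg_mixture_le (hp : p.HolderConjugate α) {q τ κ : ℝ} (hq : 0 < q) (hq4 : q ≤ 1 / 4)
    (hτ : τ ≤ 1 / 4) (hατ : α * τ ^ 2 ≤ Real.log (1 + 1 / (q * (α - 1))) / 2)
    {F : E → ℝ≥0∞} (hF : Measurable F) (m v v' : E) (hv : ‖v‖ ≤ τ) (hv' : ‖v'‖ ≤ τ) :
    ENNReal.ofReal (1 - q) * gaussAvg κ F m + ENNReal.ofReal q * gaussAvg κ F (m - κ • v) ≤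
      ENNReal.ofReal (Real.exp (momentConst * (α - 1) * q ^ 2 * τ ^ 2)) *
        (ENNReal.ofReal (1 - q) * gaussAvg κ (fun x => F x ^ p) m +
          ENNReal.ofReal q * gaussAvg κ (fun x => F x ^ p) (m - κ • v')) ^ (1 / p) := by
  have hα := hp.symm.lt
  have hα0 := hp.symm.pos
  have hFp : Measurable (fun x => F x ^ p) := hF.pow_const p
  have hF' : Measurable (fun x => F (m - κ • x)) := hF.comp (by fun_prop)
  set c := ENNReal.ofReal (Real.exp (momentConst * (α - 1) * q ^ 2 * τ ^ 2)) with hc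
  have hmom : ∀ u : E, ‖u‖ ≤ τ →
      (∫⁻ x, ENNReal.ofReal (mixDensity q u x ^ α) ∂(stdGaussian E)) ^ (1 / α) ≤ c ∧
      (∫⁻ x, ENNReal.ofReal (mixDensity q u x ^ (1 - α)) ∂(stdGaussian E)) ^ (1 / α) ≤ c := by
    intro u hu
    have hu2 : ‖u‖ ^ 2 ≤ τ ^ 2 := by gcongr
    have h := lintegral_mixture_rpow_le hα hq hq4 (norm_nonneg u) (hu.trans hτ)
      ((mul_le_mul_of_nonneg_left hu2 hα0.le).trans hατ)
    have hce : (ENNReal.ofReal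
        (Real.exp (momentConst * (α * (α - 1)) * q ^ 2 * ‖u‖ ^ 2))) ^ (1 / α) ≤ c := by
      rw [ofReal_exp_rpow]
      refine ENNReal.ofReal_le_ofReal (Real.exp_le_exp.2 ?_)
      have : momentConst * (α * (α - 1)) * q ^ 2 * ‖u‖ ^ 2 * (1 / α) =
          momentConst * (α - 1) * q ^ 2 * ‖u‖ ^ 2 := by field_simp
      rw [this]
      have h1 := momentConst_nonneg
      have h2 : 0 ≤ α - 1 := by linarith
      gcongr
    rw [lintegral_mixDensity_rpow, lintegral_mixDensity_rpow]
    exact ⟨(ENNReal.rpow_le_rpow h.1 (by positivity)).trans hce,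
      (ENNReal.rpow_le_rpow h.2 (by positivity)).trans hce⟩
  have h1 : ENNReal.ofReal (1 - 2 * q) * gaussAvg κ F m +
      ENNReal.ofReal (2 * q) * gaussAvg κ F (m - κ • v) ≤
        c * gaussAvg κ (fun x => F x ^ p) m ^ (1 / p) := by
    rw [← lintegral_mul_mixDensity hq hq4 κ hF]
    refine (lintegral_mul_ofReal_le hp hF' (measurable_mixDensity q v)
      (mixDensity_pos hq hq4 v)).trans ?_
    exact mul_le_mul_left (hmom v hv).1 _
  have h2 : gaussAvg κ F m ≤ c * (ENNReal.ofReal (1 - 2 * q) * gaussAvg κ (fun x => F x ^ p) m +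
      ENNReal.ofReal (2 * q) * gaussAvg κ (fun x => F x ^ p) (m - κ • v')) ^ (1 / p) := by
    rw [← lintegral_mul_mixDensity hq hq4 κ hFp]
    refine (lintegral_le_mul_lintegral_mul_ofReal hp hF' (measurable_mixDensity q v')
      (mixDensity_pos hq hq4 v')).trans ?_
    exact mul_le_mul_left (hmom v' hv').2 _
  -- Each mixture is half a mixture with doubled weight 2q and half the pure Gaussian at `m`.
  -- Pairing the halves crosswise (`h1`, `h2`) compares a mixture with a pure Gaussian each time, so
  -- `v` and `v'` never occur in one likelihood ratio.
  have hsplit : ∀ a b : ℝ≥0∞, ENNReal.ofReal (1 - q) * a + ENNReal.ofReal q * b =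
      2⁻¹ * (ENNReal.ofReal (1 - 2 * q) * a + ENNReal.ofReal (2 * q) * b) + 2⁻¹ * a := by
    intro a b
    have h2' : (2⁻¹ : ℝ≥0∞) = ENNReal.ofReal (1 / 2) := by
      rw [one_div, ENNReal.ofReal_inv_of_pos two_pos]; simp
    have h3 : ENNReal.ofReal (1 - q) =
        ENNReal.ofReal (1 / 2) * ENNReal.ofReal (1 - 2 * q) + ENNReal.ofReal (1 / 2) := by
      rw [← ENNReal.ofReal_mul (by norm_num), ← ENNReal.ofReal_add (by linarith) (by norm_num)]
      congr 1; ring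
    have h4 : ENNReal.ofReal q = ENNReal.ofReal (1 / 2) * ENNReal.ofReal (2 * q) := by
      rw [← ENNReal.ofReal_mul (by norm_num)]; congr 1; ring
    rw [h2', h3, h4]; ring
  rw [hsplit, hsplit]
  calc _ ≤ 2⁻¹ * (c * gaussAvg κ (fun x => F x ^ p) m ^ (1 / p)) +
        2⁻¹ * (c * (ENNReal.ofReal (1 - 2 * q) * gaussAvg κ (fun x => F x ^ p) m +
      ENNReal.ofReal (2 * q) * gaussAvg κ (fun x => F x ^ p) (m - κ • v')) ^ (1 / p)) := by
        gcongr
    _ = c * (2⁻¹ * (ENNReal.ofReal (1 - 2 * q) * gaussAvg κ (fun x => F x ^ p) m +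
          ENNReal.ofReal (2 * q) * gaussAvg κ (fun x => F x ^ p) (m - κ • v')) ^ (1 / p) +
        2⁻¹ * gaussAvg κ (fun x => F x ^ p) m ^ (1 / p)) := by ring
    _ ≤ _ := mul_le_mul_right (half_rpow_add_half_rpow_le hp _ _) _

end GaussAvg

/-! ### Resampling a uniform batch by swapping one index. -/

section Batches

variable {n b : ℕ}

/-- The pairs `(R, j)` of a batch `R` of size `b` that avoids the index `i`, and `j ∈ R`. -/
def swapPairs (n b : ℕ) (i : Fin n) : Finset (Σ _ : Finset (Fin n), Fin n) :=
  (((Finset.univ : Finset (Fin n)).powersetCard b).filter (fun R => i ∉ R)).sigma (fun R => R)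

lemma mem_swapPairs {i : Fin n} {x : Σ _ : Finset (Fin n), Fin n} :
    x ∈ swapPairs n b i ↔ (x.1.card = b ∧ i ∉ x.1) ∧ x.2 ∈ x.1 := by
  simp [swapPairs, Finset.mem_powersetCard]

/-- The sum over all batches as a sum over pairs of adjacent batches `R` and `R - j + i`. -/
lemma sum_powersetCard_eq_sum_swapPairs (i : Fin n) (hb : 1 ≤ b) (hbn : b < n)
    (F : Finset (Fin n) → ℝ≥0∞) :
    ∑ B ∈ (Finset.univ : Finset (Fin n)).powersetCard b, F B =
      ∑ x ∈ swapPairs n b i,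
        ((b : ℝ≥0∞)⁻¹ * F x.1 + ((n - b : ℕ) : ℝ≥0∞)⁻¹ * F (insert i (x.1.erase x.2))) := by
  have hb0 : (b : ℝ≥0∞) ≠ 0 := by simp; omega
  have hnb0 : ((n - b : ℕ) : ℝ≥0∞) ≠ 0 := by simp only [ne_eq, Nat.cast_eq_zero]; omega
  -- A batch avoiding `i` comes from b pairs (the choices of j in it); a batch containing `i` comes
  -- from n - b pairs (the choices of j outside it).
  rw [Finset.sum_add_distrib, ← Finset.sum_filter_add_sum_filter_not _ (fun B => i ∉ B)]
  congr 1
  · rw [swapPairs, Finset.sum_sigma]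
    refine Finset.sum_congr rfl fun R hR => ?_
    rw [Finset.mem_filter, Finset.mem_powersetCard] at hR
    dsimp only
    rw [Finset.sum_const, hR.1.2, nsmul_eq_mul, ← mul_assoc,
      ENNReal.mul_inv_cancel hb0 (by simp), one_mul]
  · have h1 : ∑ x ∈ swapPairs n b i,
        ((n - b : ℕ) : ℝ≥0∞)⁻¹ * F (insert i (x.1.erase x.2)) =
        ∑ x ∈ (((Finset.univ : Finset (Fin n)).powersetCard b).filter
          (fun B => ¬ i ∉ B)).sigma (fun B => Bᶜ), ((n - b : ℕ) : ℝ≥0∞)⁻¹ * F x.1 := by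
      refine Finset.sum_nbij' (fun x => ⟨insert i (x.1.erase x.2), x.2⟩)
        (fun x => ⟨insert x.2 (x.1.erase i), x.2⟩) ?_ ?_ ?_ ?_ ?_
      · rintro ⟨R, j⟩ h
        rw [mem_swapPairs] at h
        obtain ⟨⟨hc, hi⟩, hj⟩ := h
        have hij : j ≠ i := fun h => hi (h ▸ hj)
        simp only [Finset.mem_sigma, Finset.mem_filter, Finset.mem_powersetCard,
          Finset.subset_univ, true_and, Finset.mem_compl, Finset.mem_insert, Finset.mem_erase,
          not_not, true_or, and_true]
        refine ⟨?_, by simp [hij]⟩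
        rw [Finset.card_insert_of_notMem (by simp [hi]), Finset.card_erase_of_mem hj]
        omega
      · rintro ⟨B, j⟩ h
        simp only [Finset.mem_sigma, Finset.mem_filter, Finset.mem_powersetCard,
          Finset.subset_univ, true_and, Finset.mem_compl, not_not] at h
        obtain ⟨⟨hc, hi⟩, hj⟩ := h
        have hij : j ≠ i := fun h => hj (h ▸ hi)
        rw [mem_swapPairs]
        refine ⟨⟨?_, ?_⟩, by simp⟩
        · rw [Finset.card_insert_of_notMem (by simp [hj]), Finset.card_erase_of_mem hi]
          omega
        · simp [hij.symm]
      · rintro ⟨R, j⟩ h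
        rw [mem_swapPairs] at h
        obtain ⟨⟨hc, hi⟩, hj⟩ := h
        simp only [Sigma.mk.injEq, heq_eq_eq, and_true]
        rw [Finset.erase_insert (by simp [hi]), Finset.insert_erase hj]
      · rintro ⟨B, j⟩ h
        simp only [Finset.mem_sigma, Finset.mem_filter, Finset.mem_powersetCard,
          Finset.subset_univ, true_and, Finset.mem_compl, not_not] at h
        obtain ⟨⟨hc, hi⟩, hj⟩ := h
        simp only [Sigma.mk.injEq, heq_eq_eq, and_true]
        rw [Finset.erase_insert (by simp [hj]), Finset.insert_erase hi]
      · intro x _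
        rfl
    rw [h1, Finset.sum_sigma]
    refine Finset.sum_congr rfl fun B hB => ?_
    rw [Finset.mem_filter, Finset.mem_powersetCard] at hB
    dsimp only
    rw [Finset.sum_const, Finset.card_compl, hB.1.2, Fintype.card_fin, nsmul_eq_mul, ← mul_assoc,
      ENNReal.mul_inv_cancel hnb0 (by simp), one_mul]

lemma choose_inv_sum_one (hbn : b ≤ n) :
    ∑ _B ∈ (Finset.univ : Finset (Fin n)).powersetCard b, (n.choose b : ℝ≥0∞)⁻¹ = 1 := by
  rw [Finset.sum_const, Finset.card_powersetCard, Finset.card_univ, Fintype.card_fin,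
    nsmul_eq_mul, ENNReal.mul_inv_cancel _ (by simp)]
  simpa using (Nat.choose_pos hbn).ne'

/-- Resampling: a uniform batch is distributed as `R` with probability `1 - b / n`, and as
`R - j + i` otherwise, for a uniform pair `(R, j)`. -/
lemma exists_weight_swapPairs (i : Fin n) (hb : 1 ≤ b) (hbn : b < n) :
    ∃ w : ℝ≥0∞, ∑ _x ∈ swapPairs n b i, w = 1 ∧ ∀ F : Finset (Fin n) → ℝ≥0∞,
      (n.choose b : ℝ≥0∞)⁻¹ * ∑ B ∈ (Finset.univ : Finset (Fin n)).powersetCard b, F B =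
        ∑ x ∈ swapPairs n b i, w * (ENNReal.ofReal (1 - (b : ℝ) / n) * F x.1 +
          ENNReal.ofReal ((b : ℝ) / n) * F (insert i (x.1.erase x.2))) := by
  have hb0 : (0 : ℝ) < b := by exact_mod_cast hb
  have hn0 : (0 : ℝ) < n := by exact_mod_cast (by omega : 0 < n)
  have hnb : (0 : ℝ) < n - b := by rw [sub_pos]; exact_mod_cast hbn
  have hq1 : 0 < 1 - (b : ℝ) / n := by rw [sub_pos, div_lt_one hn0]; exact_mod_cast hbn
  -- `W` is the number for which W(1 - b/n) = 1/b and W(b/n) = 1/(n-b).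
  set W := ENNReal.ofReal (n / (b * (n - b))) with hW
  have hW1 : (b : ℝ≥0∞)⁻¹ = W * ENNReal.ofReal (1 - (b : ℝ) / n) := by
    rw [hW, ← ENNReal.ofReal_mul (by positivity), ← ENNReal.ofReal_natCast,
      ← ENNReal.ofReal_inv_of_pos hb0]
    congr 1
    field_simp
  have hW2 : ((n - b : ℕ) : ℝ≥0∞)⁻¹ = W * ENNReal.ofReal ((b : ℝ) / n) := by
    rw [hW, ← ENNReal.ofReal_mul (by positivity), ← ENNReal.ofReal_natCast,
      Nat.cast_sub hbn.le, ← ENNReal.ofReal_inv_of_pos hnb]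
    congr 1
    field_simp
  have key : ∀ F : Finset (Fin n) → ℝ≥0∞,
      (n.choose b : ℝ≥0∞)⁻¹ * ∑ B ∈ (Finset.univ : Finset (Fin n)).powersetCard b, F B =
        ∑ x ∈ swapPairs n b i, ((n.choose b : ℝ≥0∞)⁻¹ * W) *
          (ENNReal.ofReal (1 - (b : ℝ) / n) * F x.1 +
          ENNReal.ofReal ((b : ℝ) / n) * F (insert i (x.1.erase x.2))) := by
    intro F
    rw [sum_powersetCard_eq_sum_swapPairs i hb hbn, Finset.mul_sum]
    refine Finset.sum_congr rfl fun x _ => ?_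
    rw [hW1, hW2]
    ring
  refine ⟨_, ?_, key⟩
  have h := key (fun _ => 1)
  rw [Finset.mul_sum] at h
  simp only [mul_one] at h
  rw [choose_inv_sum_one hbn.le, ← ENNReal.ofReal_add hq1.le (by positivity), sub_add_cancel,
    ENNReal.ofReal_one] at h
  simpa using h.symm

end Batches

/-! ### One noisy step: privacy and shift absorption. -/

section Step

variable {E : Type*} [NormedAddCommGroup E] [InnerProductSpace ℝ E] [FiniteDimensional ℝ E]
  [MeasurableSpace E] [BorelSpace E] {p α : ℝ}

/-- Privacy of one sampled Gaussian step. -/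
lemma batch_gaussAvg_le (hp : p.HolderConjugate α) {n b : ℕ} (i : Fin n) (hb : 1 ≤ b)
    (hbn : b ≤ n) {κ r : ℝ} (hκ : 0 < κ) {F : E → ℝ≥0∞} (hF : Measurable F)
    {m m' : Finset (Fin n) → E}
    (hmm : ∀ B, i ∉ B → m B = m' B) (hclose : ∀ B, B.card = b → ‖m B - m' B‖ ≤ r)
    (hswap : ∀ R j, R.card = b → i ∉ R → j ∈ R → ‖m (insert i (R.erase j)) - m R‖ ≤ r)
    (hswap' : ∀ R j, R.card = b → i ∉ R → j ∈ R → ‖m' (insert i (R.erase j)) - m' R‖ ≤ r)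
    (hrκ : r / κ ≤ 1 / 4)
    (hα : α * (r / κ) ^ 2 ≤ Real.log (1 + 1 / ((b : ℝ) / n * (α - 1))) / 2) :
    (n.choose b : ℝ≥0∞)⁻¹ * ∑ B ∈ (Finset.univ : Finset (Fin n)).powersetCard b,
        gaussAvg κ F (m B) ≤
      ENNReal.ofReal (Real.exp ((momentConst + 8) * (α - 1) * ((b : ℝ) / n) ^ 2 * (r / κ) ^ 2)) *
        ((n.choose b : ℝ≥0∞)⁻¹ * ∑ B ∈ (Finset.univ : Finset (Fin n)).powersetCard b,
          gaussAvg κ (fun x => F x ^ p) (m' B)) ^ (1 / p) := by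
  have hα1 : 0 ≤ α - 1 := by linarith [hp.symm.lt]
  have hb0 : (0 : ℝ) < b := by exact_mod_cast hb
  have hn0 : (0 : ℝ) < n := by exact_mod_cast (by omega : 0 < n)
  have hq0 : 0 < (b : ℝ) / n := by positivity
  have hmc := momentConst_nonneg
  -- For b/n > 1/4 sampling need not help: each batch is compared directly at cost (α-1)(r/κ)²/2,
  -- and the 8 in the constant pays for it since 8(b/n)² ≥ 1/2.
  rcases le_or_gt ((b : ℝ) / n) (1 / 4) with hq | hq
  · have hbn' : b < n := by
      rw [div_le_iff₀ hn0] at hq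
      have : (b : ℝ) < n := by linarith
      exact_mod_cast this
    obtain ⟨w, hw, hwF⟩ := exists_weight_swapPairs i hb hbn'
    rw [hwF, hwF]
    have hvec : ∀ u u' : E, u' = u - κ • (-(κ⁻¹ • (u' - u))) := fun u u' => by
      rw [smul_neg, smul_smul, mul_inv_cancel₀ hκ.ne', one_smul]; abel
    have hnorm : ∀ u : E, ‖u‖ ≤ r → ‖-(κ⁻¹ • u)‖ ≤ r / κ := fun u hu => by
      rw [norm_neg, norm_smul, norm_inv, Real.norm_of_nonneg hκ.le, inv_mul_eq_div]
      gcongr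
    have hterm : ∀ x ∈ swapPairs n b i,
        w * (ENNReal.ofReal (1 - (b : ℝ) / n) * gaussAvg κ F (m x.1) +
          ENNReal.ofReal ((b : ℝ) / n) * gaussAvg κ F (m (insert i (x.1.erase x.2)))) ≤
        ENNReal.ofReal (Real.exp
          ((momentConst + 8) * (α - 1) * ((b : ℝ) / n) ^ 2 * (r / κ) ^ 2)) *
        (w * (ENNReal.ofReal (1 - (b : ℝ) / n) * gaussAvg κ (fun x => F x ^ p) (m' x.1) +
          ENNReal.ofReal ((b : ℝ) / n) *
            gaussAvg κ (fun x => F x ^ p) (m' (insert i (x.1.erase x.2)))) ^ (1 / p)) := by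
      intro x hx
      rw [mem_swapPairs] at hx
      obtain ⟨⟨hc, hi⟩, hj⟩ := hx
      have h := gaussAvg_mixture_le (κ := κ) hp hq0 hq hrκ hα hF (m x.1)
        _ _ (hnorm _ (hswap _ _ hc hi hj)) (hnorm _ (hswap' _ _ hc hi hj))
      -- As `x.1` avoids `i`, both mixtures have the same main centre; only the swapped batches
      -- differ.
      rw [← hvec, hmm _ hi, ← hvec] at h
      rw [hmm _ hi, mul_left_comm]
      refine mul_le_mul_right (h.trans (mul_le_mul_left (ENNReal.ofReal_le_ofReal
        (Real.exp_le_exp.2 ?_)) _)) _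
      gcongr
      linarith
    refine (Finset.sum_le_sum hterm).trans ?_
    rw [← Finset.mul_sum]
    exact mul_le_mul_right (sum_mul_rpow_le hp _ (fun _ => w) _ hw) _
  · rw [Finset.mul_sum, Finset.mul_sum]
    have hterm : ∀ B ∈ (Finset.univ : Finset (Fin n)).powersetCard b,
        (n.choose b : ℝ≥0∞)⁻¹ * gaussAvg κ F (m B) ≤
        ENNReal.ofReal (Real.exp
          ((momentConst + 8) * (α - 1) * ((b : ℝ) / n) ^ 2 * (r / κ) ^ 2)) *
        ((n.choose b : ℝ≥0∞)⁻¹ * gaussAvg κ (fun x => F x ^ p) (m' B) ^ (1 / p)) := by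
      intro B hB
      rw [Finset.mem_powersetCard] at hB
      have h := gaussAvg_add_le hp hκ hF (m' B) (m B - m' B) (hclose B hB.2)
      rw [add_sub_cancel] at h
      rw [mul_left_comm]
      refine mul_le_mul_right (h.trans (mul_le_mul_left (ENNReal.ofReal_le_ofReal
        (Real.exp_le_exp.2 ?_)) _)) _
      have h1 : 1 / 2 ≤ (momentConst + 8) * ((b : ℝ) / n) ^ 2 := by nlinarith
      have h2 : 0 ≤ (α - 1) * (r / κ) ^ 2 := by positivity
      nlinarith
    refine (Finset.sum_le_sum hterm).trans ?_
    rw [← Finset.mul_sum]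
    exact mul_le_mul_right (sum_mul_rpow_le hp _ (fun _ => _) _ (choose_inv_sum_one hbn)) _

/-- One step of the comparison: privacy of the sampled Gaussian step for one half of the noise, and
absorption of the shifts `h B` by the other half. -/
lemma batch_gaussAvg_add_le (hp : p.HolderConjugate α) {n b : ℕ} (i : Fin n) (hb : 1 ≤ b)
    (hbn : b ≤ n) {κ r δ : ℝ} (hκ : 0 < κ) {F : E → ℝ≥0∞} (hF : Measurable F)
    {m m' h : Finset (Fin n) → E} (hh : ∀ B, ‖h B‖ ≤ δ)
    (hmm : ∀ B, i ∉ B → m B = m' B) (hclose : ∀ B, B.card = b → ‖m B - m' B‖ ≤ r)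
    (hswap : ∀ R j, R.card = b → i ∉ R → j ∈ R → ‖m (insert i (R.erase j)) - m R‖ ≤ r)
    (hswap' : ∀ R j, R.card = b → i ∉ R → j ∈ R → ‖m' (insert i (R.erase j)) - m' R‖ ≤ r)
    (hrκ : r / (κ * (√2)⁻¹) ≤ 1 / 4)
    (hα : α * (r / (κ * (√2)⁻¹)) ^ 2 ≤
      Real.log (1 + 1 / ((b : ℝ) / n * (α - 1))) / 2) :
    (n.choose b : ℝ≥0∞)⁻¹ * ∑ B ∈ (Finset.univ : Finset (Fin n)).powersetCard b,
        gaussAvg κ F (m B + h B) ≤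
      ENNReal.ofReal (Real.exp ((α - 1) * ((momentConst + 8) * ((b : ℝ) / n) ^ 2 *
        (r / (κ * (√2)⁻¹)) ^ 2 + (δ / (κ * (√2)⁻¹)) ^ 2 / 2))) *
        ((n.choose b : ℝ≥0∞)⁻¹ * ∑ B ∈ (Finset.univ : Finset (Fin n)).powersetCard b,
          gaussAvg κ (fun x => F x ^ p) (m' B)) ^ (1 / p) := by
  have hFp : Measurable (fun x => F x ^ p) := hF.pow_const p
  set k := κ * (√2)⁻¹ with hk
  have hk0 : 0 < k := by positivity
  set c₂ := ENNReal.ofReal (Real.exp ((α - 1) * (δ / k) ^ 2 / 2)) with hc₂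
  -- The inner half of the noise absorbs the shift and produces `H`; the outer half carries the
  -- privacy comparison. As H^p is again a Gaussian average, the two halves recombine on the right.
  set H : E → ℝ≥0∞ := fun y => gaussAvg k (fun x => F x ^ p) y ^ (1 / p) with hH
  have hHm : Measurable H := (measurable_gaussAvg k hFp).pow_const _
  have h1 : ∀ B, gaussAvg κ F (m B + h B) ≤ c₂ * gaussAvg k H (m B) := by
    intro B
    rw [← gaussAvg_gaussAvg κ hF, ← gaussAvg_const_mul k c₂ hHm]
    unfold gaussAvg
    refine lintegral_mono fun x => ?_
    have := gaussAvg_add_le hp hk0 hF (m B - k • x) (h B) (hh B)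
    have he : m B + h B - k • x = m B - k • x + h B := by abel
    change gaussAvg k F (m B + h B - k • x) ≤ _
    rw [he]
    exact this
  have h2 := batch_gaussAvg_le hp i hb hbn hk0 hHm hmm hclose hswap hswap' hrκ hα
  have hHp : (fun x => H x ^ p) = gaussAvg k (fun x => F x ^ p) := by
    ext y
    rw [hH]
    simp only
    rw [← ENNReal.rpow_mul, one_div_mul_cancel hp.pos.ne', ENNReal.rpow_one]
  rw [hHp] at h2
  simp_rw [hk, gaussAvg_gaussAvg κ hFp] at h2
  rw [← hk] at h2
  calc _ ≤ (n.choose b : ℝ≥0∞)⁻¹ * ∑ B ∈ (Finset.univ : Finset (Fin n)).powersetCard b,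
        c₂ * gaussAvg k H (m B) := mul_le_mul_right (Finset.sum_le_sum fun B _ => h1 B) _
    _ = c₂ * ((n.choose b : ℝ≥0∞)⁻¹ * ∑ B ∈ (Finset.univ : Finset (Fin n)).powersetCard b,
        gaussAvg k H (m B)) := by rw [← Finset.mul_sum, mul_left_comm]
    _ ≤ _ := by
        refine (mul_le_mul_right h2 _).trans_eq ?_
        rw [← mul_assoc, hc₂, ← ENNReal.ofReal_mul (Real.exp_pos _).le, ← Real.exp_add]
        congr 3
        ring_nf

end Step

/-! ### From the dual inequality to the Rényi divergence. -/

section Renyi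

variable {p α : ℝ}

/-- A dual bound on the Rényi divergence. -/
lemma renyiDiv_le_of_forall_lintegral_le {Ω : Type*} [MeasurableSpace Ω] {μ ν : Measure Ω}
    [IsProbabilityMeasure μ] [IsProbabilityMeasure ν] (hp : p.HolderConjugate α) {t : ℝ}
    (h : ∀ f : Ω → ℝ≥0∞, Measurable f →
      ∫⁻ x, f x ∂μ ≤ ENNReal.ofReal (Real.exp t) * (∫⁻ x, f x ^ p ∂ν) ^ (1 / p)) :
    renyiDiv α μ ν ≤ (((α - 1)⁻¹ * (α * t) : ℝ) : EReal) := by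
  have hα := hp.symm.lt
  have hα0 := hp.symm.pos
  have hp0 := hp.pos
  have hac : μ ≪ ν := by
    refine Measure.AbsolutelyContinuous.mk fun s hs hν => ?_
    have h1 := h (s.indicator 1) (measurable_one.indicator hs)
    have h2 : ∀ x, (s.indicator (1 : Ω → ℝ≥0∞) x) ^ p = s.indicator 1 x := fun x => by
      by_cases hx : x ∈ s <;> simp [hx, hp0]
    simp_rw [h2] at h1
    rw [lintegral_indicator_one hs, lintegral_indicator_one hs, hν,
      ENNReal.zero_rpow_of_pos (by positivity), mul_zero] at h1
    exact le_antisymm h1 bot_le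
  set ρ := μ.rnDeriv ν with hρ
  have hρm : Measurable ρ := Measure.measurable_rnDeriv μ ν
  set c := ENNReal.ofReal (Real.exp t) with hc
  -- The extremal test function ρ^(α-1) is truncated so that I is finite and I ≤ c I^(1/p) can be
  -- divided by I^(1/p); monotone convergence removes the truncation.
  have hN : ∀ N : ℕ, ∫⁻ x, (min (ρ x) N) ^ α ∂ν ≤ c ^ α := by
    intro N
    have hmin : Measurable (fun x => min (ρ x) (N : ℝ≥0∞)) := hρm.min measurable_const
    set I := ∫⁻ x, (min (ρ x) N) ^ α ∂ν with hI
    have hItop : I ≠ ∞ := by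
      have h1 : I ≤ ∫⁻ _, (N : ℝ≥0∞) ^ α ∂ν :=
        lintegral_mono fun x => ENNReal.rpow_le_rpow (min_le_right _ _) hα0.le
      rw [lintegral_const, measure_univ, mul_one] at h1
      exact ne_top_of_le_ne_top (ENNReal.rpow_ne_top_of_nonneg hα0.le (by simp)) h1
    have h1 := h (fun x => min (ρ x) (N : ℝ≥0∞) ^ (α - 1)) (hmin.pow_const _)
    have h2 : ∀ x, (min (ρ x) (N : ℝ≥0∞) ^ (α - 1)) ^ p = min (ρ x) N ^ α := fun x => by
      rw [← ENNReal.rpow_mul, hp.symm.sub_one_mul_conj]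
    simp_rw [h2] at h1
    have h3 : I ≤ ∫⁻ x, min (ρ x) (N : ℝ≥0∞) ^ (α - 1) ∂μ := by
      rw [← Measure.withDensity_rnDeriv_eq μ ν hac,
        lintegral_withDensity_eq_lintegral_mul _ hρm (hmin.pow_const _)]
      refine lintegral_mono fun x => ?_
      simp only [Pi.mul_apply]
      have h4 : min (ρ x) (N : ℝ≥0∞) ^ α =
          min (ρ x) (N : ℝ≥0∞) * min (ρ x) (N : ℝ≥0∞) ^ (α - 1) := by
        conv_rhs => rw [← ENNReal.rpow_one (min (ρ x) (N : ℝ≥0∞)), ← ENNReal.rpow_mul]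
        rw [← ENNReal.rpow_add_of_nonneg _ _ zero_le_one (by linarith)]
        ring_nf
      rw [h4]
      exact mul_le_mul_left (min_le_left _ _) _
    have h5 : I ≤ c * I ^ (1 / p) := h3.trans h1
    rcases eq_or_ne I 0 with h0 | h0
    · rw [h0]; exact bot_le
    have h6 : I ^ (1 / α) * I ^ (1 / p) ≤ c * I ^ (1 / p) := by
      rw [← ENNReal.rpow_add _ _ h0 hItop, one_div, one_div, hp.symm.inv_add_inv_eq_one,
        ENNReal.rpow_one, ← one_div]
      exact h5
    have h7 : I ^ (1 / α) ≤ c := by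
      refine (ENNReal.mul_le_mul_iff_left ?_ ?_).1 h6
      · exact (ENNReal.rpow_pos (pos_iff_ne_zero.2 h0) hItop).ne'
      · exact ENNReal.rpow_ne_top_of_nonneg (by positivity) hItop
    have h8 := ENNReal.rpow_le_rpow h7 hα0.le
    rwa [← ENNReal.rpow_mul, one_div_mul_cancel hα0.ne', ENNReal.rpow_one] at h8
  have hint : ∫⁻ x, ρ x ^ α ∂ν ≤ c ^ α := by
    have hlim : ∀ x, Filter.Tendsto (fun N : ℕ => min (ρ x) (N : ℝ≥0∞) ^ α) Filter.atTop
        (nhds (ρ x ^ α)) := by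
      intro x
      refine (ENNReal.continuous_rpow_const.tendsto _).comp ?_
      have h1 : Filter.Tendsto (fun N : ℕ => min (ρ x) (N : ℝ≥0∞)) Filter.atTop
          (nhds (min (ρ x) ∞)) :=
        tendsto_const_nhds.min ENNReal.tendsto_nat_nhds_top
      rwa [min_eq_left le_top] at h1
    refine le_of_tendsto' (lintegral_tendsto_of_tendsto_of_monotone
      (fun N => ((hρm.min measurable_const).pow_const α).aemeasurable)
      (Filter.Eventually.of_forall fun x N M hNM => ?_)
      (Filter.Eventually.of_forall hlim)) hN
    exact ENNReal.rpow_le_rpow (min_le_min le_rfl (by exact_mod_cast hNM)) hα0.le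
  rw [renyiDiv, if_pos hac, EReal.coe_mul]
  refine mul_le_mul_of_nonneg_left ?_ (EReal.coe_nonneg.2 (inv_nonneg.2 (by linarith)))
  refine (ENNReal.log_monotone hint).trans_eq ?_
  rw [hc, ofReal_exp_rpow, ENNReal.log_ofReal, if_neg (not_le.2 (Real.exp_pos _)), Real.log_exp,
    mul_comm]

end Renyi

/-! ### Comparison of two Markov chains started at different points. -/

section Chain

/-- With k + 1 steps left, the fraction 1/(k+1) of the displacement is absorbed now; the rest fits
the budget of k steps. -/
lemma norm_sub_div_smul_le {E : Type*} [NormedAddCommGroup E] [NormedSpace ℝ E] {u : E} {k : ℕ} {Δ : ℝ} (h : ‖u‖ ≤ (k + 1) * Δ) :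
    ‖((k : ℝ) + 1)⁻¹ • u‖ ≤ Δ ∧ ‖u - ((k : ℝ) + 1)⁻¹ • u‖ ≤ k * Δ := by
  have hk : (0 : ℝ) < k + 1 := by positivity
  constructor
  · rw [norm_smul, norm_inv, Real.norm_of_nonneg hk.le, inv_mul_le_iff₀ hk]
    exact h
  · have h1 : u - ((k : ℝ) + 1)⁻¹ • u = (k / (k + 1) : ℝ) • u := by
      rw [← one_smul ℝ u, smul_smul, ← sub_smul, smul_smul]
      congr 1
      field_simp
      ring
    rw [h1, norm_smul, Real.norm_of_nonneg (by positivity), div_mul_eq_mul_div, div_le_iff₀ hk]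
    have : (0 : ℝ) ≤ k := by positivity
    nlinarith

variable {E : Type*} [NormedAddCommGroup E] [InnerProductSpace ℝ E] [FiniteDimensional ℝ E]
  [MeasurableSpace E] [BorelSpace E] {p α : ℝ}

/-- The transition operator of the chain `w ↦ pr (φ B w - κ z)`, where `B` is a uniform batch of size
`b` and `z` is a standard Gaussian. -/
noncomputable def chainOp {n : ℕ} (b : ℕ) (κ : ℝ) (pr : E → E) (φ : Finset (Fin n) → E → E)
    (f : E → ℝ≥0∞) (x : E) : ℝ≥0∞ :=
  (n.choose b : ℝ≥0∞)⁻¹ * ∑ B ∈ (Finset.univ : Finset (Fin n)).powersetCard b,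
    gaussAvg κ (fun y => f (pr y)) (φ B x)

variable {n b : ℕ} {κ : ℝ} {pr : E → E} {φ φ' : Finset (Fin n) → E → E}

lemma measurable_chainOp (hpr : Measurable pr) (hφ : ∀ B, Measurable (φ B)) {f : E → ℝ≥0∞}
    (hf : Measurable f) : Measurable (chainOp b κ pr φ f) := by
  have : ∀ B, Measurable fun x => gaussAvg κ (fun y => f (pr y)) (φ B x) := fun B =>
    (measurable_gaussAvg κ (hf.comp hpr)).comp (hφ B)
  unfold chainOp
  fun_prop

lemma measurable_iterate_chainOp (hpr : Measurable pr) (hφ : ∀ B, Measurable (φ B))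
    {f : E → ℝ≥0∞} (hf : Measurable f) (k : ℕ) : Measurable ((chainOp b κ pr φ)^[k] f) := by
  induction k with
  | zero => exact hf
  | succ k ih =>
    rw [Function.iterate_succ_apply']
    exact measurable_chainOp hpr hφ ih

/-- A Harnack type inequality that compares two chains started at different points, at the price of
absorbing a shift of size `Δ` by the noise of each step. -/
lemma iterate_chainOp_le (hp : p.HolderConjugate α) (i : Fin n) (hb : 1 ≤ b) (hbn : b ≤ n)
    {r Δ : ℝ} (hκ : 0 < κ) {K : Set E} (hpr : Measurable pr) (hprK : ∀ x, pr x ∈ K)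
    (hprdist : ∀ x y, ‖pr x - pr y‖ ≤ ‖x - y‖)
    (hφm' : ∀ B, Measurable (φ' B))
    (hφ : ∀ B, ∀ x ∈ K, ∀ y ∈ K, ‖φ B x - φ B y‖ ≤ ‖x - y‖)
    (hmm : ∀ B, i ∉ B → φ B = φ' B)
    (hclose : ∀ y ∈ K, ∀ B, B.card = b → ‖φ B y - φ' B y‖ ≤ r)
    (hswap : ∀ y ∈ K, ∀ R j, R.card = b → i ∉ R → j ∈ R →
      ‖φ (insert i (R.erase j)) y - φ R y‖ ≤ r)
    (hswap' : ∀ y ∈ K, ∀ R j, R.card = b → i ∉ R → j ∈ R →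
      ‖φ' (insert i (R.erase j)) y - φ' R y‖ ≤ r)
    (hrκ : r / (κ * (√2)⁻¹) ≤ 1 / 4)
    (hα : α * (r / (κ * (√2)⁻¹)) ^ 2 ≤
      Real.log (1 + 1 / ((b : ℝ) / n * (α - 1))) / 2)
    {f : E → ℝ≥0∞} (hf : Measurable f) (k : ℕ) :
    ∀ x ∈ K, ∀ y ∈ K, ‖x - y‖ ≤ k * Δ → (chainOp b κ pr φ)^[k] f x ≤
      ENNReal.ofReal (Real.exp ((α - 1) * ((momentConst + 8) * ((b : ℝ) / n) ^ 2 *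
        (r / (κ * (√2)⁻¹)) ^ 2 + (Δ / (κ * (√2)⁻¹)) ^ 2 / 2))) ^ k *
      ((chainOp b κ pr φ')^[k] (fun z => f z ^ p) y) ^ (1 / p) := by
  set c := ENNReal.ofReal (Real.exp ((α - 1) * ((momentConst + 8) * ((b : ℝ) / n) ^ 2 *
        (r / (κ * (√2)⁻¹)) ^ 2 + (Δ / (κ * (√2)⁻¹)) ^ 2 / 2))) with hc
  induction k with
  | zero =>
    intro x _ y _ hxy
    have : x = y := by
      rw [← sub_eq_zero, ← norm_le_zero_iff]; simpa using hxy
    rw [this]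
    simp [← ENNReal.rpow_mul, hp.pos.ne']
  | succ k ih =>
    intro x hx y hy hxy
    rw [Function.iterate_succ_apply', Function.iterate_succ_apply']
    set u := (chainOp b κ pr φ)^[k] f with hu
    set v := (chainOp b κ pr φ')^[k] (fun z => f z ^ p) with hv
    have hvm : Measurable v := measurable_iterate_chainOp hpr hφm' (hf.pow_const p) k
    have hFm : Measurable (fun z => v (pr z) ^ (1 / p)) := (hvm.comp hpr).pow_const _
    set h : Finset (Fin n) → E := fun B => ((k : ℝ) + 1)⁻¹ • (φ B x - φ B y) with hh
    have hn : ∀ B, ‖φ B x - φ B y‖ ≤ (k + 1) * Δ := fun B =>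
      (hφ B x hx y hy).trans (by simpa using hxy)
    have hstep := batch_gaussAvg_add_le hp i hb hbn hκ hFm (h := h) (δ := Δ)
      (fun B => (norm_sub_div_smul_le (hn B)).1) (m := fun B => φ B y) (m' := fun B => φ' B y)
      (fun B hB => by rw [hmm B hB]) (hclose y hy) (hswap y hy) (hswap' y hy) hrκ hα
    have hpow : ∀ z, (v (pr z) ^ (1 / p)) ^ p = v (pr z) := fun z => by
      rw [← ENNReal.rpow_mul, one_div_mul_cancel hp.pos.ne', ENNReal.rpow_one]
    simp_rw [hpow] at hstep
    -- Both chains use the same batch and the same noise here. After `h B` is taken out,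
    -- nonexpansiveness leaves the next iterates within kΔ, so the induction hypothesis applies
    -- pointwise.
    have hterm : ∀ B, gaussAvg κ (fun z => u (pr z)) (φ B x) ≤
        c ^ k * gaussAvg κ (fun z => v (pr z) ^ (1 / p)) (φ B y + h B) := by
      intro B
      rw [← gaussAvg_const_mul _ _ hFm]
      refine lintegral_mono fun z => ?_
      refine ih _ (hprK _) _ (hprK _) ((hprdist _ _).trans ?_)
      have : φ B x - κ • z - (φ B y + h B - κ • z) = (φ B x - φ B y) - h B := by abel
      rw [this]
      exact (norm_sub_div_smul_le (hn B)).2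
    calc chainOp b κ pr φ u x ≤ (n.choose b : ℝ≥0∞)⁻¹ *
          ∑ B ∈ (Finset.univ : Finset (Fin n)).powersetCard b,
            c ^ k * gaussAvg κ (fun z => v (pr z) ^ (1 / p)) (φ B y + h B) :=
          mul_le_mul_right (Finset.sum_le_sum fun B _ => hterm B) _
      _ = c ^ k * ((n.choose b : ℝ≥0∞)⁻¹ *
          ∑ B ∈ (Finset.univ : Finset (Fin n)).powersetCard b,
            gaussAvg κ (fun z => v (pr z) ^ (1 / p)) (φ B y + h B)) := by
          rw [← Finset.mul_sum, mul_left_comm]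
      _ ≤ c ^ k * (c * chainOp b κ pr φ' v y ^ (1 / p)) := mul_le_mul_right hstep _
      _ = _ := by rw [pow_succ, mul_assoc]

end Chain

/-! ### Euclidean projection onto a closed convex set. -/

section Projection

variable {E : Type*} [NormedAddCommGroup E] [InnerProductSpace ℝ E] [CompleteSpace E] {K : Set E}

lemma proj_spec (hne : K.Nonempty) (hc : IsClosed K) (hK : Convex ℝ K) (x : E) :
    proj K x ∈ K ∧ ∀ w ∈ K, inner ℝ (x - proj K x) (w - proj K x) ≤ 0 := by
  obtain ⟨v, hv, hmin⟩ := exists_norm_eq_iInf_of_complete_convex hne hc.isComplete hK x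
  have hbdd : BddBelow (Set.range fun w : K => ‖x - w‖) :=
    ⟨0, by rintro _ ⟨w, rfl⟩; exact norm_nonneg _⟩
  have hex : ∃ y ∈ K, ∀ y' ∈ K, dist x y ≤ dist x y' := by
    refine ⟨v, hv, fun y' hy' => ?_⟩
    rw [dist_eq_norm, dist_eq_norm, hmin]
    exact ciInf_le hbdd (⟨y', hy'⟩ : K)
  have hp : proj K x = hex.choose := by rw [proj, dif_pos hex]
  obtain ⟨h1, h2⟩ := hex.choose_spec
  rw [← hp] at h1 h2
  refine ⟨h1, (norm_eq_iInf_iff_real_inner_le_zero hK h1).1 (le_antisymm ?_ ?_)⟩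
  · have : Nonempty K := hne.to_subtype
    refine le_ciInf fun w => ?_
    rw [← dist_eq_norm, ← dist_eq_norm]
    exact h2 w w.2
  · exact ciInf_le hbdd (⟨_, h1⟩ : K)

lemma proj_mem (hne : K.Nonempty) (hc : IsClosed K) (hK : Convex ℝ K) (x : E) : proj K x ∈ K :=
  (proj_spec hne hc hK x).1

lemma proj_unique (hc : IsClosed K) (hK : Convex ℝ K) {x y : E} (hy : y ∈ K)
    (h : ∀ w ∈ K, inner ℝ (x - y) (w - y) ≤ 0) : proj K x = y := by
  obtain ⟨h1, h2⟩ := proj_spec ⟨y, hy⟩ hc hK x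
  have h3 := h _ h1
  have h4 := h2 _ hy
  have h5 : inner ℝ (proj K x - y) (proj K x - y) =
      inner ℝ (x - y) (proj K x - y) + inner ℝ (x - proj K x) (y - proj K x) := by
    simp only [inner_sub_left, inner_sub_right]; ring
  rw [← sub_eq_zero, ← norm_eq_zero, ← sq_eq_zero_iff, ← real_inner_self_eq_norm_sq]
  exact le_antisymm (h5 ▸ add_nonpos h3 h4) real_inner_self_nonneg

lemma proj_of_mem (hc : IsClosed K) (hK : Convex ℝ K) {x : E} (hx : x ∈ K) : proj K x = x :=
  proj_unique hc hK hx (by simp)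

lemma norm_proj_sub_proj_le (hne : K.Nonempty) (hc : IsClosed K) (hK : Convex ℝ K) (x y : E) :
    ‖proj K x - proj K y‖ ≤ ‖x - y‖ := by
  obtain ⟨h1, h2⟩ := proj_spec hne hc hK x
  obtain ⟨h3, h4⟩ := proj_spec hne hc hK y
  have h5 := h2 _ h3
  have h6 := h4 _ h1
  have h7 : ‖proj K x - proj K y‖ ^ 2 ≤ inner ℝ (x - y) (proj K x - proj K y) := by
    rw [← real_inner_self_eq_norm_sq]
    have : inner ℝ (x - y) (proj K x - proj K y) -
        inner ℝ (proj K x - proj K y) (proj K x - proj K y) =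
        - inner ℝ (x - proj K x) (proj K y - proj K x) -
          inner ℝ (y - proj K y) (proj K x - proj K y) := by
      simp only [inner_sub_left, inner_sub_right]; ring
    linarith
  have h8 := real_inner_le_norm (x - y) (proj K x - proj K y)
  rcases (norm_nonneg (proj K x - proj K y)).eq_or_lt with h | h
  · rw [← h]; exact norm_nonneg _
  · nlinarith

lemma continuous_proj (hne : K.Nonempty) (hc : IsClosed K) (hK : Convex ℝ K) :
    Continuous (proj K) :=
  (LipschitzWith.of_dist_le_mul (K := 1) fun x y => by
    simpa [dist_eq_norm] using norm_proj_sub_proj_le hne hc hK x y).continuous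

/-- Displacements orthogonal to the affine span of `K` do not affect the projection onto `K`. -/
lemma proj_add_of_orthogonal (hne : K.Nonempty) (hc : IsClosed K) (hK : Convex ℝ K) (x : E) {u : E}
    (hu : ∀ v ∈ vectorSpan ℝ K, inner ℝ u v = 0) : proj K (x + u) = proj K x := by
  obtain ⟨h1, h2⟩ := proj_spec hne hc hK x
  refine proj_unique hc hK h1 fun w hw => ?_
  have h3 := hu (w - proj K x) (vsub_mem_vectorSpan ℝ hw h1)
  have h4 : x + u - proj K x = (x - proj K x) + u := by abel
  rw [h4, inner_add_left, h3, add_zero]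
  exact h2 w hw

end Projection

/-! ### Relative interior points of a convex set. -/

section RelInterior

variable {E : Type*} [NormedAddCommGroup E] [InnerProductSpace ℝ E] {K : Set E}

/-- Points of the segment from `w ∈ K` to a relative interior point are relative interior points. -/
lemma relative_ball_segment (hK : Convex ℝ K) {c w : E} {r t : ℝ} (hw : w ∈ K) (ht0 : 0 < t)
    (ht1 : t ≤ 1) (hc : ∀ v ∈ vectorSpan ℝ K, ‖v‖ ≤ r → c + v ∈ K) :
    ∀ v ∈ vectorSpan ℝ K, ‖v‖ ≤ t * r → w + t • (c - w) + v ∈ K := by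
  intro v hv hvr
  have h1 : c + t⁻¹ • v ∈ K := by
    refine hc _ (Submodule.smul_mem _ _ hv) ?_
    rw [norm_smul, norm_inv, Real.norm_of_nonneg ht0.le, inv_mul_le_iff₀ ht0]
    exact hvr
  have h2 := hK hw h1 (by linarith : 0 ≤ 1 - t) ht0.le (by ring)
  convert h2 using 1
  rw [smul_add, smul_smul, mul_inv_cancel₀ ht0.ne', one_smul]
  module

variable [FiniteDimensional ℝ E]

lemma exists_relative_ball (hne : K.Nonempty) (hK : Convex ℝ K) :
    ∃ c, ∃ r > 0, ∀ v ∈ vectorSpan ℝ K, ‖v‖ ≤ r → c + v ∈ K := by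
  obtain ⟨c, hc⟩ := hne.intrinsicInterior hK
  rw [mem_intrinsicInterior] at hc
  obtain ⟨y, hy, rfl⟩ := hc
  rw [mem_interior_iff_mem_nhds, Metric.mem_nhds_iff] at hy
  obtain ⟨r, hr, hball⟩ := hy
  refine ⟨y, r / 2, by positivity, fun v hv hvr => ?_⟩
  rw [← direction_affineSpan] at hv
  have hmem := AffineSubspace.vadd_mem_of_mem_direction hv y.2
  have : (⟨v +ᵥ (y : E), hmem⟩ : affineSpan ℝ K) ∈ Metric.ball y r := by
    rw [Metric.mem_ball, Subtype.dist_eq]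
    simp only [vadd_eq_add, dist_add_self_left]
    linarith
  have h := hball this
  simp only [Set.mem_preimage, vadd_eq_add] at h
  rwa [add_comm]

end RelInterior

/-! ### First order inequalities for convex smooth losses on K. -/

section Loss

variable {E : Type*} [NormedAddCommGroup E] [InnerProductSpace ℝ E] [CompleteSpace E]
  {K : Set E} {L M : ℝ} {f : E → ℝ} {g : E → E}

lemma IsLoss.hasDerivWithinAt_line (hf : IsLoss K L M f g) (hK : Convex ℝ K) {x y : E} (hx : x ∈ K)
    (hy : y ∈ K) {t : ℝ} (ht : t ∈ Set.Icc (0 : ℝ) 1) :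
    HasDerivWithinAt (fun s : ℝ => f (x + s • (y - x))) (inner ℝ (g (x + t • (y - x))) (y - x))
      (Set.Icc 0 1) t := by
  have hmaps : Set.MapsTo (fun s : ℝ => x + s • (y - x)) (Set.Icc 0 1) K := fun s hs =>
    hK.add_smul_sub_mem hx hy hs
  have h1 := (hf.grad _ (hmaps ht)).hasFDerivWithinAt
  have h2 : HasDerivWithinAt (fun s : ℝ => x + s • (y - x)) (y - x) (Set.Icc 0 1) t := by
    simpa using (((hasDerivAt_id t).smul_const (y - x)).const_add x).hasDerivWithinAt
  have h3 := h1.comp_hasDerivWithinAt t h2 hmaps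
  rwa [InnerProductSpace.toDual_apply_apply] at h3

lemma IsLoss.inner_le_sub (hf : IsLoss K L M f g) (hK : Convex ℝ K) {x y : E} (hx : x ∈ K)
    (hy : y ∈ K) : inner ℝ (g x) (y - x) ≤ f y - f x := by
  have hconv : ConvexOn ℝ (Set.Icc (0 : ℝ) 1) (fun s : ℝ => f (x + s • (y - x))) := by
    refine ⟨convex_Icc 0 1, fun s hs t ht a b ha hb hab => ?_⟩
    have h := hf.convex.2 (hK.add_smul_sub_mem hx hy hs) (hK.add_smul_sub_mem hx hy ht) ha hb hab
    refine le_trans (le_of_eq ?_) h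
    obtain rfl : b = 1 - a := by linarith
    simp only [smul_eq_mul]
    congr 1
    module
  have hd := hf.hasDerivWithinAt_line hK hx hy (t := 0) (by simp)
  have h := hconv.le_slope_of_hasDerivWithinAt (x := 0) (y := 1) (by simp) (by simp) one_pos hd
  simpa [slope] using h

lemma IsLoss.le_quadratic (hf : IsLoss K L M f g) (hK : Convex ℝ K) {x y : E} (hx : x ∈ K)
    (hy : y ∈ K) : f y ≤ f x + inner ℝ (g x) (y - x) + M / 2 * ‖y - x‖ ^ 2 := by
  have hd := fun t (ht : t ∈ Set.Icc (0 : ℝ) 1) => hf.hasDerivWithinAt_line hK hx hy ht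
  have hB : ∀ t : ℝ, HasDerivAt (fun s : ℝ => f x + s * inner ℝ (g x) (y - x) +
      M / 2 * s ^ 2 * ‖y - x‖ ^ 2) (inner ℝ (g x) (y - x) + M * t * ‖y - x‖ ^ 2) t := by
    intro t
    have h1 := (((hasDerivAt_id t).mul_const (inner ℝ (g x) (y - x))).const_add (f x)).add
      ((((hasDerivAt_id t).pow 2).const_mul (M / 2)).mul_const (‖y - x‖ ^ 2))
    refine h1.congr_deriv ?_
    simp only [one_mul, id, Nat.cast_ofNat]
    ring
  have h := image_le_of_deriv_right_le_deriv_boundary (a := 0) (b := 1)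
    (fun t ht => (hd t ht).continuousWithinAt)
    (fun t ht => (hd t ⟨ht.1, ht.2.le⟩).mono_of_mem_nhdsWithin
      (Filter.mem_of_superset (Icc_mem_nhdsGE ht.2) (Set.Icc_subset_Icc_left ht.1)))
    (B := fun s : ℝ => f x + s * inner ℝ (g x) (y - x) + M / 2 * s ^ 2 * ‖y - x‖ ^ 2)
    (B' := fun t => inner ℝ (g x) (y - x) + M * t * ‖y - x‖ ^ 2)
    (by simp) (fun t _ => (hB t).continuousAt.continuousWithinAt)
    (fun t _ => (hB t).hasDerivWithinAt) (fun t ht => ?_) (x := 1) (by simp)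
  · simpa using h
  · have hm : x + t • (y - x) ∈ K := hK.add_smul_sub_mem hx hy ⟨ht.1, ht.2.le⟩
    have h1 := hf.smooth _ hm _ hx
    have h2 : inner ℝ (g (x + t • (y - x))) (y - x) - inner ℝ (g x) (y - x) ≤
        M * t * ‖y - x‖ ^ 2 := by
      rw [← inner_sub_left]
      refine (real_inner_le_norm _ _).trans ?_
      rw [add_sub_cancel_left, norm_smul, Real.norm_of_nonneg ht.1] at h1
      have := mul_le_mul_of_nonneg_right h1 (norm_nonneg (y - x))
      linarith
    linarith

lemma IsLoss.continuousOn_grad (hf : IsLoss K L M f g) :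
    ContinuousOn g K :=
  (LipschitzOnWith.of_dist_le_mul (K := M.toNNReal) fun x hx y hy => by
    rw [dist_eq_norm, dist_eq_norm]
    exact (hf.smooth x hx y hy).trans
      (mul_le_mul_of_nonneg_right (Real.le_coe_toNNReal M) (norm_nonneg _))).continuousOn

end Loss

/-! ### Nonexpansive gradient steps and bounds on tangential gradients. -/

section TangentGradient

variable {E : Type*} [NormedAddCommGroup E] [InnerProductSpace ℝ E]

/-- Expanding the square, ‖v - ηd‖² ≤ ‖v‖² - η(2 - ηM)⟨d, v⟩; this is where the stepsize condition
enters. -/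
lemma norm_sub_smul_le {v d : E} {η M : ℝ} (hη : 0 ≤ η) (hM : 0 < M) (hηM : η ≤ 2 / M)
    (h : ‖d‖ ^ 2 ≤ M * inner ℝ d v) : ‖v - η • d‖ ≤ ‖v‖ := by
  refine le_of_sq_le_sq ?_ (norm_nonneg _)
  rw [norm_sub_sq_real, real_inner_smul_right, norm_smul, Real.norm_of_nonneg hη,
    real_inner_comm]
  rw [le_div_iff₀ hM] at hηM
  have h1 : 0 ≤ inner ℝ d v := by nlinarith [sq_nonneg ‖d‖]
  nlinarith [mul_nonneg hη h1, mul_le_mul_of_nonneg_left h hη]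

lemma le_of_forall_le_add_mul {a b c : ℝ} (h : ∀ t : ℝ, 0 < t → t ≤ 1 → a ≤ b + t * c) :
    a ≤ b := by
  by_contra! hab
  have hc : 0 < |c| + 1 := by positivity
  set t := min 1 ((a - b) / (2 * (|c| + 1))) with ht
  have ht0 : 0 < t := lt_min one_pos (div_pos (by linarith) (by positivity))
  have h1 := h t ht0 (min_le_left _ _)
  have h2 : t * (2 * (|c| + 1)) ≤ a - b := by
    rw [← le_div_iff₀ (by positivity)]; exact min_le_right _ _
  nlinarith [le_abs_self c, mul_le_mul_of_nonneg_left (le_abs_self c) ht0.le]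

variable [FiniteDimensional ℝ E]

/-- The component of `u` along the affine span of `K`. -/
noncomputable def tangent (K : Set E) (u : E) : E := (vectorSpan ℝ K).starProjection u

variable {K : Set E} {L M : ℝ} {f : E → ℝ} {g : E → E}

lemma tangent_mem (u : E) : tangent K u ∈ vectorSpan ℝ K := Submodule.starProjection_apply_mem _ _

lemma tangent_sub (u v : E) : tangent K (u - v) = tangent K u - tangent K v := map_sub _ _ _

lemma norm_tangent_le (u : E) : ‖tangent K u‖ ≤ ‖u‖ := Submodule.norm_starProjection_apply_le _ _

lemma inner_tangent (u : E) {v : E} (hv : v ∈ vectorSpan ℝ K) :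
    inner ℝ (tangent K u) v = inner ℝ u v := by
  have h := Submodule.starProjection_inner_eq_zero (K := vectorSpan ℝ K) u v hv
  rw [inner_sub_left, sub_eq_zero] at h
  exact h.symm

lemma IsLoss.tangent_smooth (hf : IsLoss K L M f g) {x y : E} (hx : x ∈ K) (hy : y ∈ K) :
    ‖tangent K (g x) - tangent K (g y)‖ ≤ M * ‖x - y‖ := by
  rw [← tangent_sub]
  exact (norm_tangent_le _).trans (hf.smooth x hx y hy)

/-- Co-coercivity of the gradient near a relative interior point. -/
lemma IsLoss.cocoercive (hf : IsLoss K L M f g) (hK : Convex ℝ K) (hM : 0 < M) {x y : E} {r : ℝ}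
    (hx : x ∈ K) (hy : y ∈ K) (hxr : ∀ v ∈ vectorSpan ℝ K, ‖v‖ ≤ r → x + v ∈ K)
    (hr : 2 * ‖y - x‖ ≤ r) :
    ‖tangent K (g y) - tangent K (g x)‖ ^ 2 ≤
      M * inner ℝ (tangent K (g y) - tangent K (g x)) (y - x) := by
  set d := tangent K (g y) - tangent K (g x) with hd
  have hyx : y - x ∈ vectorSpan ℝ K := vsub_mem_vectorSpan ℝ hy hx
  have hdV : d ∈ vectorSpan ℝ K := Submodule.sub_mem _ (tangent_mem _) (tangent_mem _)
  have hdin : ∀ v ∈ vectorSpan ℝ K, inner ℝ d v = inner ℝ (g y) v - inner ℝ (g x) v := by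
    intro v hv
    rw [hd, inner_sub_left, inner_tangent _ hv, inner_tangent _ hv]
  have hdn : ‖M⁻¹ • d‖ ≤ ‖y - x‖ := by
    rw [norm_smul, norm_inv, Real.norm_of_nonneg hM.le, inv_mul_le_iff₀ hM]
    exact hf.tangent_smooth hy hx
  have hdd : inner ℝ (g y) d - inner ℝ (g x) d = ‖d‖ ^ 2 := by
    rw [← hdin d hdV, real_inner_self_eq_norm_sq]
  have hsq : M / 2 * ‖M⁻¹ • d‖ ^ 2 = M⁻¹ / 2 * ‖d‖ ^ 2 := by
    rw [norm_smul, norm_inv, Real.norm_of_nonneg hM.le]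
    field_simp
  -- The usual proof of co-coercivity evaluates the loss at y - d/M and x + d/M. Both lie in K
  -- because ‖d/M‖ ≤ ‖y - x‖ and the ball at `x` has radius at least 2‖y - x‖.
  have hz₁ : y - M⁻¹ • d ∈ K := by
    have := hxr (y - x - M⁻¹ • d) (Submodule.sub_mem _ hyx (Submodule.smul_mem _ _ hdV))
      ((norm_sub_le _ _).trans (by linarith))
    convert this using 1
    abel
  have hz₂ : x + M⁻¹ • d ∈ K :=
    hxr _ (Submodule.smul_mem _ _ hdV) (by linarith [norm_nonneg (y - x)])
  have h₁ := hf.inner_le_sub hK hx hz₁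
  have h₂ := hf.le_quadratic hK hy hz₁
  have h₃ := hf.inner_le_sub hK hy hz₂
  have h₄ := hf.le_quadratic hK hx hz₂
  rw [sub_sub_cancel_left, norm_neg, hsq, inner_neg_right, real_inner_smul_right] at h₂
  rw [add_sub_cancel_left, hsq, real_inner_smul_right] at h₄
  have e₁ : y - M⁻¹ • d - x = (y - x) - M⁻¹ • d := by abel
  have e₃ : x + M⁻¹ • d - y = M⁻¹ • d - (y - x) := by abel
  rw [e₁, inner_sub_right, real_inner_smul_right] at h₁
  rw [e₃, inner_sub_right, real_inner_smul_right] at h₃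
  rw [hdin _ hyx]
  have h₅ : M⁻¹ * ‖d‖ ^ 2 ≤ inner ℝ (g y) (y - x) - inner ℝ (g x) (y - x) := by
    rw [← hdd] at h₂ h₄ ⊢
    linarith
  rwa [inv_mul_le_iff₀ hM] at h₅

/-- The gradient step along the affine span of `K`. -/
noncomputable def gradStep (K : Set E) (η : ℝ) (g : E → E) (x : E) : E := x - η • tangent K (g x)

lemma gradStep_sub_gradStep (η : ℝ) (x y : E) : gradStep K η g x - gradStep K η g y =
    (x - y) - η • (tangent K (g x) - tangent K (g y)) := by
  unfold gradStep; module

/-- Co-coercivity is available only for points close together relative to r, so the segment is cut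
into N short pieces, all of whose nodes inherit the ball of radius r by convexity. -/
lemma IsLoss.norm_gradStep_sub_le_of_ball (hf : IsLoss K L M f g) (hK : Convex ℝ K) (hM : 0 < M)
    {η : ℝ} (hη : 0 ≤ η) (hηM : η ≤ 2 / M) {x y : E} {r : ℝ} (hr : 0 < r)
    (hxr : ∀ v ∈ vectorSpan ℝ K, ‖v‖ ≤ r → x + v ∈ K)
    (hyr : ∀ v ∈ vectorSpan ℝ K, ‖v‖ ≤ r → y + v ∈ K) :
    ‖gradStep K η g x - gradStep K η g y‖ ≤ ‖x - y‖ := by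
  obtain ⟨N, hN⟩ := exists_nat_gt (2 * ‖y - x‖ / r)
  have hN0 : (0 : ℝ) < N := lt_of_le_of_lt (by positivity) hN
  set z : ℕ → E := fun k => x + (k / N : ℝ) • (y - x) with hz
  have hz0 : z 0 = x := by simp [hz]
  have hzN : z N = y := by simp [hz, div_self hN0.ne']
  have hzz : ∀ k, z (k + 1) - z k = (N : ℝ)⁻¹ • (y - x) := fun k => by
    simp only [hz, Nat.cast_add, Nat.cast_one, add_div, one_div]
    module
  have hzr : ∀ k ≤ N, ∀ v ∈ vectorSpan ℝ K, ‖v‖ ≤ r → z k + v ∈ K := by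
    intro k hk v hv hvr
    have hk1 : (k / N : ℝ) ≤ 1 := by
      rw [div_le_one hN0]; exact_mod_cast hk
    have := hK (hxr v hv hvr) (hyr v hv hvr) (sub_nonneg.2 hk1)
      (by positivity : (0 : ℝ) ≤ k / N) (by ring)
    convert this using 1
    simp only [hz]
    module
  have hzK : ∀ k ≤ N, z k ∈ K := fun k hk => by
    simpa using hzr k hk 0 (Submodule.zero_mem _) (by simpa using hr.le)
  have hstep : ∀ k < N, ‖gradStep K η g (z (k + 1)) - gradStep K η g (z k)‖ ≤
      (N : ℝ)⁻¹ * ‖y - x‖ := by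
    intro k hk
    rw [gradStep_sub_gradStep]
    refine (norm_sub_smul_le hη hM hηM (hf.cocoercive hK hM (hzK k hk.le) (hzK (k + 1) hk)
      (hzr k hk.le) ?_)).trans_eq ?_
    · rw [hzz, norm_smul, norm_inv, Real.norm_of_nonneg hN0.le]
      rw [div_lt_iff₀ hr] at hN
      rw [mul_left_comm, inv_mul_le_iff₀ hN0]
      exact hN.le
    · rw [hzz, norm_smul, norm_inv, Real.norm_of_nonneg hN0.le]
  have hsum := dist_le_range_sum_dist (fun k => gradStep K η g (z k)) N
  rw [hz0, hzN, dist_eq_norm] at hsum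
  refine hsum.trans ((Finset.sum_le_sum fun k hk => ?_).trans_eq
    (b := ∑ _k ∈ Finset.range N, (N : ℝ)⁻¹ * ‖y - x‖) ?_)
  · rw [dist_comm, dist_eq_norm]
    exact hstep k (Finset.mem_range.1 hk)
  · rw [Finset.sum_const, Finset.card_range, nsmul_eq_mul, ← mul_assoc,
      mul_inv_cancel₀ hN0.ne', one_mul, norm_sub_rev]

/-- Gradient steps are nonexpansive on `K`, although nothing is assumed outside of `K`. -/
lemma IsLoss.norm_gradStep_sub_le (hf : IsLoss K L M f g) (hK : Convex ℝ K) (hM : 0 < M)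
    {η : ℝ} (hη : 0 ≤ η) (hηM : η ≤ 2 / M) {x y : E} (hx : x ∈ K) (hy : y ∈ K) :
    ‖gradStep K η g x - gradStep K η g y‖ ≤ ‖x - y‖ := by
  obtain ⟨c, r, hr, hcr⟩ := exists_relative_ball ⟨x, hx⟩ hK
  have hc : c ∈ K := by simpa using hcr 0 (Submodule.zero_mem _) (by simpa using hr.le)
  have hmove : ∀ w ∈ K, ∀ t : ℝ, 0 < t → t ≤ 1 →
      ‖gradStep K η g w - gradStep K η g (w + t • (c - w))‖ ≤ t * ((1 + η * M) * ‖c - w‖) := by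
    intro w hw t ht0 ht1
    have hm : w + t • (c - w) ∈ K := hK.add_smul_sub_mem hw hc ⟨ht0.le, ht1⟩
    have h1 := hf.tangent_smooth hw hm
    rw [gradStep_sub_gradStep]
    refine (norm_sub_le _ _).trans ?_
    rw [norm_smul, Real.norm_of_nonneg hη]
    have h2 : ‖w - (w + t • (c - w))‖ = t * ‖c - w‖ := by
      rw [sub_add_cancel_left, norm_neg, norm_smul, Real.norm_of_nonneg ht0.le]
    rw [h2] at h1 ⊢
    nlinarith [mul_le_mul_of_nonneg_left h1 hη]
  -- Both points are moved a fraction t towards a relative interior point, where balls of radius tr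
  -- fit in K; the error is O(t) and t → 0.
  refine le_of_forall_le_add_mul
    (c := (1 + η * M) * ‖c - x‖ + (1 + η * M) * ‖c - y‖) fun t ht0 ht1 => ?_
  have h1 := hf.norm_gradStep_sub_le_of_ball hK hM hη hηM (mul_pos ht0 hr)
    (relative_ball_segment hK hx ht0 ht1 hcr) (relative_ball_segment hK hy ht0 ht1 hcr)
  have h2 : ‖x + t • (c - x) - (y + t • (c - y))‖ ≤ ‖x - y‖ := by
    have : x + t • (c - x) - (y + t • (c - y)) = (1 - t) • (x - y) := by module
    rw [this, norm_smul, Real.norm_of_nonneg (by linarith)]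
    nlinarith [norm_nonneg (x - y)]
  have h3 := hmove x hx t ht0 ht1
  have h4 := hmove y hy t ht0 ht1
  have h5 : gradStep K η g x - gradStep K η g y =
      (gradStep K η g x - gradStep K η g (x + t • (c - x))) +
      (gradStep K η g (x + t • (c - x)) - gradStep K η g (y + t • (c - y))) -
      (gradStep K η g y - gradStep K η g (y + t • (c - y))) := by abel
  rw [h5]
  refine (norm_sub_le _ _).trans ((add_le_add_left (norm_add_le _ _) _).trans ?_)
  linarith

/-- At a relative interior point one can move along the tangential gradient itself, where convexity
and the Lipschitz bound compare; other points follow by a limit. The normal component of g is not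
controlled. -/
lemma IsLoss.norm_tangent_grad_le (hf : IsLoss K L M f g) (hK : Convex ℝ K) (hL : 0 ≤ L) {x : E} (hx : x ∈ K) :
    ‖tangent K (g x)‖ ≤ L := by
  obtain ⟨c, r, hr, hcr⟩ := exists_relative_ball ⟨x, hx⟩ hK
  have hc : c ∈ K := by simpa using hcr 0 (Submodule.zero_mem _) (by simpa using hr.le)
  refine le_of_forall_le_add_mul (c := M * ‖c - x‖) fun t ht0 ht1 => ?_
  set w := x + t • (c - x) with hw
  have hwK : w ∈ K := hK.add_smul_sub_mem hx hc ⟨ht0.le, ht1⟩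
  have hwr := relative_ball_segment hK hx ht0 ht1 hcr
  rw [← hw] at hwr
  have h1 : ‖tangent K (g w)‖ ≤ L := by
    set u := tangent K (g w) with hu
    rcases eq_or_ne u 0 with h0 | h0
    · rw [h0, norm_zero]
      exact hL
    have hun : 0 < ‖u‖ := norm_pos_iff.2 h0
    set s := t * r / ‖u‖ with hs
    have hs0 : 0 < s := by positivity
    have hsK : w + s • u ∈ K := hwr _ (Submodule.smul_mem _ _ (tangent_mem _)) (by
      rw [norm_smul, Real.norm_of_nonneg hs0.le, hs, div_mul_cancel₀ _ hun.ne'])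
    have h2 := hf.inner_le_sub hK hwK hsK
    have h3 := (le_abs_self _).trans (hf.lipschitz _ hsK _ hwK)
    rw [add_sub_cancel_left, real_inner_smul_right, ← inner_tangent _ (tangent_mem _), ← hu,
      real_inner_self_eq_norm_sq] at h2
    rw [add_sub_cancel_left, norm_smul, Real.norm_of_nonneg hs0.le] at h3
    have h4 : s * ‖u‖ * ‖u‖ ≤ s * ‖u‖ * L := by nlinarith
    exact le_of_mul_le_mul_left h4 (by positivity)
  have h2 := hf.tangent_smooth hx hwK
  have h3 : ‖x - w‖ = t * ‖c - x‖ := by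
    rw [hw, sub_add_cancel_left, norm_neg, norm_smul, Real.norm_of_nonneg ht0.le]
  rw [h3] at h2
  have h4 := norm_le_norm_add_norm_sub (tangent K (g w)) (tangent K (g x))
  rw [norm_sub_rev] at h4
  linarith

end TangentGradient

/-! ### What the condition on α provides. -/

section AlphaStar

/-- Λ decreases in α and log(s²) ≥ 0, so the bound passes from elements of `alphaSet` to all smaller
β > 1; continuity then reaches the supremum itself. An empty set is excluded because its supremum is
0 by convention. -/
lemma le_log_mul_of_le_alphaStar {q s α : ℝ} (hq : 0 < q) (hs : 1 ≤ s) (hα : 1 < α)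
    (h : α ≤ alphaStar q s) : α ≤ Real.log (1 + 1 / (q * (α - 1))) * s ^ 2 / 2 := by
  have hne : (alphaSet q s).Nonempty := by
    by_contra hne
    rw [Set.not_nonempty_iff_eq_empty] at hne
    rw [alphaStar, hne, Real.sSup_empty] at h
    linarith
  have hbelow : ∀ β, 1 < β → β < α → β ≤ Real.log (1 + 1 / (q * (β - 1))) * s ^ 2 / 2 := by
    intro β hβ hβα
    obtain ⟨a, ⟨ha1, ha2, -⟩, hβa⟩ := exists_lt_of_lt_csSup hne (hβα.trans_le h)
    have hls : 0 ≤ Real.log (s ^ 2) := Real.log_nonneg (by nlinarith)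
    have hq1 : 0 < q * (β - 1) := mul_pos hq (by linarith)
    have hmono : Real.log (1 + 1 / (q * (a - 1))) ≤ Real.log (1 + 1 / (q * (β - 1))) := by
      have ha : 0 < q * (a - 1) := mul_pos hq (by linarith)
      apply Real.log_le_log (by positivity)
      gcongr
    have := mul_le_mul_of_nonneg_right hmono (sq_nonneg s)
    linarith
  have hcont : ContinuousAt (fun β => Real.log (1 + 1 / (q * (β - 1))) * s ^ 2 / 2) α := by
    have hq1 : 0 < q * (α - 1) := mul_pos hq (by linarith)
    have h1 : 1 + 1 / (q * (α - 1)) ≠ 0 := by positivity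
    have h2 : q * (α - 1) ≠ 0 := hq1.ne'
    fun_prop (disch := assumption)
  refine le_of_tendsto_of_tendsto (b := nhdsWithin α (Set.Iio α)) (f := fun β => β)
    (Filter.tendsto_id.mono_left nhdsWithin_le_nhds)
    (hcont.tendsto.mono_left nhdsWithin_le_nhds) ?_
  filter_upwards [Ioo_mem_nhdsLT hα] with β hβ
  exact hbelow β hβ.1 hβ.2

end AlphaStar

/-! ### Noisy-SGD as a Markov chain of the above type. -/

section Chain

lemma norm_smul_smul_le {E : Type*} [NormedAddCommGroup E] [NormedSpace ℝ E] {u : E} {b : ℕ} {η c : ℝ} (hη : 0 ≤ η) (hu : ‖u‖ ≤ c) :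
    ‖η • ((b : ℝ)⁻¹ • u)‖ ≤ c * η / b := by
  rw [norm_smul, norm_smul, Real.norm_of_nonneg hη, norm_inv, Real.norm_natCast]
  calc η * ((b : ℝ)⁻¹ * ‖u‖) ≤ η * ((b : ℝ)⁻¹ * c) := by gcongr
    _ = _ := by ring

variable {E : Type*} [NormedAddCommGroup E] [InnerProductSpace ℝ E] [FiniteDimensional ℝ E]
  {n b : ℕ} {K : Set E} {L M η σ : ℝ} {g g' : Fin n → E → E}

/-- The averaged gradient step of a batch, along the affine span of `K` and extended to the whole
space by projection. -/
noncomputable def batchStep (K : Set E) (η : ℝ) (g : Fin n → E → E) (B : Finset (Fin n)) (x : E) :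
    E :=
  proj K x - η • ((B.card : ℝ)⁻¹ • ∑ i ∈ B, tangent K (g i (proj K x)))

/-- The discarded normal components of the gradients are orthogonal to the affine span of K, so the
projection does not see them. -/
lemma step_eq_proj_batchStep (hne : K.Nonempty) (hc : IsClosed K) (hK : Convex ℝ K)
    (B : Finset (Fin n)) {w : E} (hw : w ∈ K) (z : E) :
    step K η g B w z = proj K (batchStep K η g B w - η • z) := by
  have horth : ∀ v ∈ vectorSpan ℝ K, inner ℝ
      (η • ((B.card : ℝ)⁻¹ • ∑ i ∈ B, (g i w - tangent K (g i w)))) v = 0 := by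
    intro v hv
    rw [real_inner_smul_left, real_inner_smul_left, sum_inner,
      Finset.sum_eq_zero fun i _ => ?_]
    · simp
    · rw [inner_sub_left, inner_tangent _ hv, sub_self]
  rw [step, batchStep, proj_of_mem hc hK hw, ← proj_add_of_orthogonal hne hc hK _ horth]
  congr 1
  rw [Finset.sum_sub_distrib]
  module

lemma continuous_batchStep (hne : K.Nonempty) (hc : IsClosed K) (hK : Convex ℝ K)
    (hg : ∀ i, ContinuousOn (g i) K) (B : Finset (Fin n)) : Continuous (batchStep K η g B) := by
  have hp := continuous_proj hne hc hK
  have h : ∀ i, Continuous fun x => tangent K (g i (proj K x)) := fun i =>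
    (vectorSpan ℝ K).starProjection.continuous.comp
      ((hg i).comp_continuous hp (proj_mem hne hc hK))
  unfold batchStep
  fun_prop

lemma batchStep_congr (i : Fin n) (h : ∀ j, j ≠ i → g j = g' j) {B : Finset (Fin n)} (hB : i ∉ B) :
    batchStep K η g B = batchStep K η g' B := by
  ext x
  unfold batchStep
  rw [Finset.sum_congr rfl fun j hj => by rw [h j (fun hji => hB (hji ▸ hj))]]

lemma norm_batchStep_sub_le (hη : 0 ≤ η) {x : E}
    (hL : ∀ j, ‖tangent K (g j (proj K x))‖ ≤ L) (hL' : ∀ j, ‖tangent K (g' j (proj K x))‖ ≤ L)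
    (i : Fin n) (h : ∀ j, j ≠ i → g j = g' j) {B : Finset (Fin n)} (hB : B.card = b) :
    ‖batchStep K η g B x - batchStep K η g' B x‖ ≤ 2 * L * η / b := by
  have hL0 : 0 ≤ L := (norm_nonneg _).trans (hL i)
  by_cases hi : i ∈ B
  · have hsum : ∑ j ∈ B, tangent K (g' j (proj K x)) - ∑ j ∈ B, tangent K (g j (proj K x)) =
        tangent K (g' i (proj K x)) - tangent K (g i (proj K x)) := by
      rw [← Finset.sum_sub_distrib]
      refine Finset.sum_eq_single_of_mem i hi fun j _ hji => ?_
      rw [h j hji, sub_self]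
    have he : batchStep K η g B x - batchStep K η g' B x =
        η • ((b : ℝ)⁻¹ • (tangent K (g' i (proj K x)) - tangent K (g i (proj K x)))) := by
      rw [← hsum, batchStep, batchStep, hB]
      module
    rw [he]
    refine norm_smul_smul_le hη ((norm_sub_le _ _).trans ?_)
    linarith [hL i, hL' i]
  · rw [batchStep_congr i h hi, sub_self, norm_zero]
    positivity

lemma norm_batchStep_swap_sub_le (hη : 0 ≤ η) {x : E}
    (hL : ∀ j, ‖tangent K (g j (proj K x))‖ ≤ L) {i j : Fin n} {R : Finset (Fin n)}
    (hR : R.card = b) (hi : i ∉ R) (hj : j ∈ R) :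
    ‖batchStep K η g (insert i (R.erase j)) x - batchStep K η g R x‖ ≤ 2 * L * η / b := by
  have hcard : (insert i (R.erase j)).card = b := by
    rw [Finset.card_insert_of_notMem (by simp [hi]), Finset.card_erase_add_one hj, hR]
  have he : batchStep K η g (insert i (R.erase j)) x - batchStep K η g R x =
      η • ((b : ℝ)⁻¹ • (tangent K (g j (proj K x)) - tangent K (g i (proj K x)))) := by
    rw [batchStep, batchStep, hcard, hR, Finset.sum_insert (by simp [hi]),
      ← Finset.add_sum_erase R _ hj]
    module
  rw [he]
  refine norm_smul_smul_le hη ((norm_sub_le _ _).trans ?_)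
  linarith [hL i, hL j]

lemma norm_batchStep_sub_batchStep_le (hc : IsClosed K) (hK : Convex ℝ K)
    (hg : ∀ i, ∀ x ∈ K, ∀ y ∈ K, ‖gradStep K η (g i) x - gradStep K η (g i) y‖ ≤ ‖x - y‖)
    (B : Finset (Fin n)) {x y : E} (hx : x ∈ K) (hy : y ∈ K) :
    ‖batchStep K η g B x - batchStep K η g B y‖ ≤ ‖x - y‖ := by
  -- The step of an empty batch is the identity on K, as the empty sum vanishes.
  rcases B.eq_empty_or_nonempty with rfl | hB
  · simp [batchStep, proj_of_mem hc hK hx, proj_of_mem hc hK hy]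
  have hcard : (0 : ℝ) < B.card := by exact_mod_cast hB.card_pos
  have he : ∀ z ∈ K, batchStep K η g B z = (B.card : ℝ)⁻¹ • ∑ i ∈ B, gradStep K η (g i) z := by
    intro z hz
    have h1 : z = (B.card : ℝ)⁻¹ • ((B.card : ℝ) • z) := by
      rw [smul_smul, inv_mul_cancel₀ hcard.ne', one_smul]
    simp only [gradStep]
    rw [batchStep, proj_of_mem hc hK hz, Finset.sum_sub_distrib, Finset.sum_const,
      ← Finset.smul_sum, ← Nat.cast_smul_eq_nsmul ℝ, smul_sub, ← h1, smul_comm]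
  rw [he x hx, he y hy, ← smul_sub, ← Finset.sum_sub_distrib, norm_smul, norm_inv,
    Real.norm_natCast, inv_mul_le_iff₀ hcard, ← nsmul_eq_mul]
  exact (norm_sum_le _ _).trans (Finset.sum_le_card_nsmul _ _ _ fun i _ => hg i x hx y hy)

variable [MeasurableSpace E] [BorelSpace E]

instance isProbabilityMeasure_gaussianNoise (σ : ℝ) : IsProbabilityMeasure (gaussianNoise E σ) :=
  Measure.isProbabilityMeasure_map (by fun_prop)

variable {w₀ : E}

/-- The claims are tied together: `step` agrees with the projected `batchStep` only on K, so the
Markov property needs the iterates to stay in K almost surely. -/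
lemma sgdLaw_spec (hne : K.Nonempty) (hc : IsClosed K) (hK : Convex ℝ K)
    (hg : ∀ i, ContinuousOn (g i) K) (hbn : b ≤ n) (hw₀ : w₀ ∈ K) (t : ℕ) :
    IsProbabilityMeasure (sgdLaw K η σ b g w₀ t) ∧ (∀ᵐ x ∂(sgdLaw K η σ b g w₀ t), x ∈ K) ∧
    ∀ f : E → ℝ≥0∞, Measurable f → ∫⁻ x, f x ∂(sgdLaw K η σ b g w₀ (t + 1)) =
      ∫⁻ x, chainOp b (η * σ) (proj K) (batchStep K η g) f x ∂(sgdLaw K η σ b g w₀ t) := by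
  have hpc := continuous_proj hne hc hK
  have hbc := continuous_batchStep (η := η) hne hc hK hg
  have hψ : ∀ B, Measurable fun q : E × E => proj K (batchStep K η g B q.1 - η • q.2) := fun B => by
    have := hbc B
    exact Continuous.measurable (by fun_prop)
  have hsucc : ∀ t, (∀ᵐ x ∂(sgdLaw K η σ b g w₀ t), x ∈ K) → sgdLaw K η σ b g w₀ (t + 1) =
      ((n.choose b : ℝ≥0∞)⁻¹) • ∑ B ∈ (Finset.univ : Finset (Fin n)).powersetCard b,
      ((sgdLaw K η σ b g w₀ t).prod (gaussianNoise E σ)).map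
        (fun q : E × E => proj K (batchStep K η g B q.1 - η • q.2)) := by
    intro t ht
    rw [sgdLaw]
    congr 1
    refine Finset.sum_congr rfl fun B _ => Measure.map_congr ?_
    filter_upwards [Measure.quasiMeasurePreserving_fst.ae ht] with q hq
    exact step_eq_proj_batchStep hne hc hK B hq q.2
  have hprob : ∀ t, IsProbabilityMeasure (sgdLaw K η σ b g w₀ t) ∧
      ∀ᵐ x ∂(sgdLaw K η σ b g w₀ t), x ∈ K := by
    intro t
    induction t with
    | zero =>
      rw [sgdLaw]
      exact ⟨inferInstance, (ae_dirac_iff hc.measurableSet).2 hw₀⟩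
    | succ t ih =>
      obtain ⟨h1, h2⟩ := ih
      have h3 : ∀ B, IsProbabilityMeasure (((sgdLaw K η σ b g w₀ t).prod (gaussianNoise E σ)).map
        (fun q : E × E => proj K (batchStep K η g B q.1 - η • q.2))) := fun B =>
        Measure.isProbabilityMeasure_map (hψ B).aemeasurable
      rw [hsucc t h2]
      constructor
      · constructor
        simp only [Measure.smul_apply, Measure.finsetSum_apply, measure_univ, smul_eq_mul]
        rw [Finset.mul_sum]
        simpa using choose_inv_sum_one hbn
      · rw [ae_iff, show {a | a ∉ K} = Kᶜ from rfl]
        simp only [Measure.smul_apply, Measure.finsetSum_apply, smul_eq_mul]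
        rw [Finset.sum_eq_zero, mul_zero]
        intro B _
        rw [Measure.map_apply (hψ B) hc.measurableSet.compl]
        convert measure_empty (μ := (sgdLaw K η σ b g w₀ t).prod (gaussianNoise E σ))
        ext q
        simpa using proj_mem hne hc hK _
  obtain ⟨h1, h2⟩ := hprob t
  refine ⟨h1, h2, fun f hf => ?_⟩
  rw [hsucc t h2, lintegral_smul_measure, lintegral_finsetSum_measure, smul_eq_mul]
  unfold chainOp
  have hfm : Measurable fun y => f (proj K y) := hf.comp hpc.measurable
  have hm : ∀ B, Measurable fun x => gaussAvg (η * σ) (fun y => f (proj K y))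
      (batchStep K η g B x) := fun B => (measurable_gaussAvg _ hfm).comp (hbc B).measurable
  rw [lintegral_const_mul _ (Finset.measurable_sum _ fun B _ => hm B),
    lintegral_finsetSum _ fun B _ => hm B]
  congr 1
  refine Finset.sum_congr rfl fun B _ => ?_
  rw [lintegral_map hf (hψ B), lintegral_prod
    (fun q : E × E => f (proj K (batchStep K η g B q.1 - η • q.2))) (hf.comp (hψ B)).aemeasurable]
  refine lintegral_congr fun x => ?_
  rw [gaussianNoise, lintegral_map (f := fun y => f (proj K (batchStep K η g B x - η • y)))
    (hfm.comp (by fun_prop)) (by fun_prop), gaussAvg]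
  simp_rw [smul_smul]

lemma lintegral_sgdLaw_add (hne : K.Nonempty) (hc : IsClosed K) (hK : Convex ℝ K)
    (hg : ∀ i, ContinuousOn (g i) K) (hbn : b ≤ n) (hw₀ : w₀ ∈ K) (t k : ℕ) {f : E → ℝ≥0∞}
    (hf : Measurable f) :
    ∫⁻ x, f x ∂(sgdLaw K η σ b g w₀ (t + k)) =
      ∫⁻ x, (chainOp b (η * σ) (proj K) (batchStep K η g))^[k] f x
        ∂(sgdLaw K η σ b g w₀ t) := by
  induction k generalizing f with
  | zero => rfl
  | succ k ih =>
    rw [← add_assoc, (sgdLaw_spec hne hc hK hg hbn hw₀ (t + k)).2.2 f hf, Function.iterate_succ,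
      Function.comp_apply]
    exact ih (measurable_chainOp (continuous_proj hne hc hK).measurable
      (fun B => (continuous_batchStep hne hc hK hg B).measurable) hf)

end Chain

/-! ### The privacy bound. -/

section Main

variable {E : Type*} [NormedAddCommGroup E] [InnerProductSpace ℝ E] [FiniteDimensional ℝ E]
  [MeasurableSpace E] [BorelSpace E]
  {n b : ℕ} {K : Set E} {L M D η σ α : ℝ} {f f' : Fin n → E → ℝ} {g g' : Fin n → E → E} {w₀ : E}

/-- Dual form of the privacy bound. -/
lemma lintegral_sgdLaw_le {p : ℝ} (hp : p.HolderConjugate α) (hK : Convex ℝ K) (hc : IsClosed K)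
    (hbd : Bornology.IsBounded K) (hD : Metric.diam K = D) (hL : 0 < L) (hM : 0 < M)
    (hf : ∀ i, IsLoss K L M (f i) (g i)) (hf' : ∀ i, IsLoss K L M (f' i) (g' i))
    (i : Fin n) (hgg : ∀ j, j ≠ i → g j = g' j) (T : ℕ) (hb : 1 ≤ b) (hbn : b ≤ n)
    (hη : 0 < η) (hηM : η ≤ 2 / M) (hσ : 8 * √2 * L / b < σ) (hw₀ : w₀ ∈ K)
    (hα : α ≤ alphaStar ((b : ℝ) / n) (b * σ / (2 * √2 * L))) {F : E → ℝ≥0∞} (hF : Measurable F) :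
    ∫⁻ x, F x ∂(sgdLaw K η σ b g w₀ T) ≤
      ENNReal.ofReal (Real.exp ((min T ⌈D * n / (L * η)⌉₊ : ℕ) *
        ((α - 1) * ((8 * momentConst + 65) * (L ^ 2 / (n ^ 2 * σ ^ 2)))))) *
      (∫⁻ x, F x ^ p ∂(sgdLaw K η σ b g' w₀ T)) ^ (1 / p) := by
  have hne : K.Nonempty := ⟨w₀, hw₀⟩
  have hb0 : (0 : ℝ) < b := by exact_mod_cast hb
  have hn0 : (0 : ℝ) < n := by exact_mod_cast (by omega : 0 < n)
  have h2 : (0 : ℝ) < √2 := by positivity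
  have h22 : √2 ^ 2 = (2 : ℝ) := Real.sq_sqrt two_pos.le
  have hσ0 : 0 < σ := lt_trans (by positivity) hσ
  have hbσ : 8 * √2 * L < σ * b := by rwa [div_lt_iff₀ hb0] at hσ
  set s := b * σ / (2 * √2 * L) with hs
  have hs4 : 4 ≤ s := by
    rw [hs, le_div_iff₀ (by positivity)]
    linarith
  have hs0 : 0 < s := by linarith
  have hr : 2 * L * η / b / (η * σ * (√2)⁻¹) = 1 / s := by
    rw [hs]
    field_simp
  have hα' : α * (1 / s) ^ 2 ≤ Real.log (1 + 1 / ((b : ℝ) / n * (α - 1))) / 2 := by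
    have h := le_log_mul_of_le_alphaStar (by positivity) (by linarith) hp.symm.lt hα
    rw [one_div, inv_pow, ← div_eq_mul_inv, div_le_iff₀ (by positivity)]
    linarith
  have hpm := proj_mem hne hc hK
  have hpc := continuous_proj hne hc hK
  have hgc := fun i => (hf i).continuousOn_grad
  have hgc' := fun i => (hf' i).continuousOn_grad
  have hLg : ∀ x j, ‖tangent K (g j (proj K x))‖ ≤ L := fun x j =>
    (hf j).norm_tangent_grad_le hK hL.le (hpm x)
  have hLg' : ∀ x j, ‖tangent K (g' j (proj K x))‖ ≤ L := fun x j =>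
    (hf' j).norm_tangent_grad_le hK hL.le (hpm x)
  -- A swap moves the step by at most r = 2Lη/b, and r/(ησ/√2) = 1/s ≤ 1/4. The choice Δ = Lη/n
  -- makes the shift cost of the same order L²/(n²σ²) as the privacy cost.
  have hmain := fun k => iterate_chainOp_le (n := n) (b := b) (κ := η * σ) (pr := proj K)
    (φ := batchStep K η g) (φ' := batchStep K η g') (r := 2 * L * η / b) (Δ := L * η / n) (K := K)
    hp i hb hbn (by positivity) hpc.measurable hpm (norm_proj_sub_proj_le hne hc hK)
    (fun B => (continuous_batchStep hne hc hK hgc' B).measurable)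
    (fun B x hx y hy => norm_batchStep_sub_batchStep_le hc hK (fun j x hx y hy =>
      (hf j).norm_gradStep_sub_le hK hM hη.le hηM hx hy) B hx hy)
    (fun B hB => batchStep_congr i hgg hB)
    (fun y _ B hB => norm_batchStep_sub_le hη.le (hLg y) (hLg' y) i hgg hB)
    (fun y _ R j hR hi hj => norm_batchStep_swap_sub_le hη.le (hLg y) hR hi hj)
    (fun y _ R j hR hi hj => norm_batchStep_swap_sub_le hη.le (hLg' y) hR hi hj)
    (by rw [hr, div_le_div_iff₀ hs0 (by norm_num)]; linarith) (by rwa [hr]) hF k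
  have hexp : (momentConst + 8) * ((b : ℝ) / n) ^ 2 * (2 * L * η / b / (η * σ * (√2)⁻¹)) ^ 2 +
      (L * η / n / (η * σ * (√2)⁻¹)) ^ 2 / 2 =
      (8 * momentConst + 65) * (L ^ 2 / (n ^ 2 * σ ^ 2)) := by
    have e1 : ((b : ℝ) / n) ^ 2 * (2 * L * η / b / (η * σ * (√2)⁻¹)) ^ 2 =
        8 * (L ^ 2 / (n ^ 2 * σ ^ 2)) := by
      have : (b : ℝ) / n * (2 * L * η / b / (η * σ * (√2)⁻¹)) = 2 * √2 * L / (n * σ) := by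
        field_simp
      rw [← mul_pow, this, div_pow, mul_pow, mul_pow, mul_pow, h22]
      ring
    have e2 : (L * η / n / (η * σ * (√2)⁻¹)) ^ 2 = 2 * (L ^ 2 / (n ^ 2 * σ ^ 2)) := by
      have : L * η / n / (η * σ * (√2)⁻¹) = √2 * L / (n * σ) := by field_simp
      rw [this, div_pow, mul_pow, mul_pow, h22]
      ring
    rw [mul_assoc, e1, e2]
    ring
  rw [hexp] at hmain
  set A := (α - 1) * ((8 * momentConst + 65) * (L ^ 2 / (n ^ 2 * σ ^ 2))) with hA
  have hpowk : ∀ k : ℕ, ENNReal.ofReal (Real.exp A) ^ k = ENNReal.ofReal (Real.exp (k * A)) :=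
    fun k => by rw [← ENNReal.ofReal_pow (Real.exp_pos _).le, ← Real.exp_nat_mul]
  simp_rw [hpowk] at hmain
  set N := ⌈D * n / (L * η)⌉₊ with hN
  -- For T ≤ N both chains start at `w₀`, and all T steps are compared. Otherwise only the last N
  -- steps are, from arbitrary points of K, and the bound is integrated over both laws at time T -
  -- N.
  rcases le_total T N with hTN | hTN
  · rw [min_eq_left hTN]
    have h1 := lintegral_sgdLaw_add (η := η) (σ := σ) hne hc hK hgc hbn hw₀ 0 T hF
    have h3 := lintegral_sgdLaw_add (η := η) (σ := σ) hne hc hK hgc' hbn hw₀ 0 T (hF.pow_const p)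
    rw [zero_add, sgdLaw, lintegral_dirac' _ (measurable_iterate_chainOp hpc.measurable
      (fun B => (continuous_batchStep hne hc hK hgc B).measurable) hF T)] at h1
    rw [zero_add, sgdLaw, lintegral_dirac' _ (measurable_iterate_chainOp hpc.measurable
      (fun B => (continuous_batchStep hne hc hK hgc' B).measurable) (hF.pow_const p) T)] at h3
    rw [h1, h3]
    exact hmain T w₀ hw₀ w₀ hw₀ (by rw [sub_self, norm_zero]; positivity)
  · rw [min_eq_right hTN]
    obtain ⟨t, rfl⟩ := Nat.exists_eq_add_of_le' hTN
    rw [lintegral_sgdLaw_add hne hc hK hgc hbn hw₀ t N hF,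
      lintegral_sgdLaw_add hne hc hK hgc' hbn hw₀ t N (hF.pow_const p)]
    obtain ⟨hP, hPK, -⟩ := sgdLaw_spec (η := η) (σ := σ) hne hc hK hgc hbn hw₀ t
    obtain ⟨hP', hPK', -⟩ := sgdLaw_spec (η := η) (σ := σ) hne hc hK hgc' hbn hw₀ t
    set u := (chainOp b (η * σ) (proj K) (batchStep K η g))^[N] F with hu
    set v := (chainOp b (η * σ) (proj K) (batchStep K η g'))^[N] (fun z => F z ^ p) with hv
    have hvm : Measurable v := measurable_iterate_chainOp hpc.measurable
      (fun B => (continuous_batchStep hne hc hK hgc' B).measurable) (hF.pow_const p) N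
    have hNΔ : D ≤ N * (L * η / n) := by
      have h1 : D * n / (L * η) ≤ N := Nat.le_ceil _
      rw [div_le_iff₀ (by positivity)] at h1
      rw [← mul_div_assoc, le_div_iff₀ hn0]
      exact h1
    have huv : ∀ x ∈ K, ∀ y ∈ K, u x ≤ ENNReal.ofReal (Real.exp (N * A)) * v y ^ (1 / p) :=
      fun x hx y hy => hmain N x hx y hy (by
        rw [← dist_eq_norm]
        exact ((Metric.dist_le_diam_of_mem hbd hx hy).trans hD.le).trans hNΔ)
    have h1 : ∀ y ∈ K, ∫⁻ x, u x ∂(sgdLaw K η σ b g w₀ t) ≤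
        ENNReal.ofReal (Real.exp (N * A)) * v y ^ (1 / p) := by
      intro y hy
      refine (lintegral_mono_ae (hPK.mono fun x hx => huv x hx y hy)).trans_eq ?_
      rw [lintegral_const, measure_univ, mul_one]
    calc ∫⁻ x, u x ∂(sgdLaw K η σ b g w₀ t)
        = ∫⁻ _y, ∫⁻ x, u x ∂(sgdLaw K η σ b g w₀ t) ∂(sgdLaw K η σ b g' w₀ t) := by
          rw [lintegral_const, measure_univ, mul_one]
      _ ≤ ∫⁻ y, ENNReal.ofReal (Real.exp (N * A)) * v y ^ (1 / p) ∂(sgdLaw K η σ b g' w₀ t) :=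
          lintegral_mono_ae (hPK'.mono h1)
      _ = ENNReal.ofReal (Real.exp (N * A)) *
          ∫⁻ y, v y ^ (1 / p) ∂(sgdLaw K η σ b g' w₀ t) :=
          lintegral_const_mul _ (hvm.pow_const _)
      _ ≤ _ := mul_le_mul_right (lintegral_rpow_le hp hvm) _

end Main

end NoisySGD

theorem theorem3p1 :
    ∃ C : ℝ, 0 < C ∧
      ∀ (d : ℕ) (K : Set (EuclideanSpace ℝ (Fin d))) (D L M : ℝ),
        Convex ℝ K → IsClosed K → Bornology.IsBounded K → Metric.diam K = D →
        0 < L → 0 < M →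
      ∀ (𝒳 : Type*) (f : 𝒳 → EuclideanSpace ℝ (Fin d) → ℝ)
        (g : 𝒳 → EuclideanSpace ℝ (Fin d) → EuclideanSpace ℝ (Fin d)),
        (∀ x, NoisySGD.IsLoss K L M (f x) (g x)) →
      ∀ (T n b : ℕ) (η σ α : ℝ) (w₀ : EuclideanSpace ℝ (Fin d)),
        1 ≤ b → b ≤ n →
        0 < η → η ≤ 2 / M →
        8 * √2 * L / b < σ →
        w₀ ∈ K →
        1 < α → α ≤ NoisySGD.alphaStar ((b : ℝ) / n) (b * σ / (2 * √2 * L)) →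
        NoisySGD.IsRDP (n := n) (NoisySGD.noisySGD K η σ b g w₀ T) α
          (C * (α * L ^ 2 / (n ^ 2 * σ ^ 2)) * min (T : ℝ) (⌈D * n / (L * η)⌉₊ : ℝ)) := by
  -- 8(`momentConst` + 8) from privacy plus 1 from the shifts.
  refine ⟨8 * NoisySGD.momentConst + 65, by linarith [NoisySGD.momentConst_nonneg], ?_⟩
  intro d K D L M hK hc hbd hD hL hM 𝒳 f g hf T n b η σ α w₀ hb hbn hη hηM hσ hw₀ hα1 hα X X' hX
  have hne : K.Nonempty := ⟨w₀, hw₀⟩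
  obtain ⟨i, hi⟩ : ∃ i : Fin n, ∀ j, j ≠ i → X j = X' j := by
    rcases hX with rfl | h
    -- For equal datasets any index will do; one exists since 1 ≤ b ≤ n.
    · exact ⟨⟨0, by omega⟩, fun _ _ => rfl⟩
    · exact h
  have hp : (α.conjExponent).HolderConjugate α := (Real.HolderConjugate.conjExponent hα1).symm
  have hP := (NoisySGD.sgdLaw_spec (η := η) (σ := σ) hne hc hK
    (fun j => (hf (X j)).continuousOn_grad) hbn hw₀ T).1
  have hP' := (NoisySGD.sgdLaw_spec (η := η) (σ := σ) hne hc hK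
    (fun j => (hf (X' j)).continuousOn_grad) hbn hw₀ T).1
  have h := NoisySGD.renyiDiv_le_of_forall_lintegral_le hp fun F hF =>
    NoisySGD.lintegral_sgdLaw_le hp hK hc hbd hD hL hM (fun j => hf (X j)) (fun j => hf (X' j)) i
      (fun j hj => by rw [hi j hj]) T hb hbn hη hηM hσ hw₀ hα hF
  refine h.trans_eq ?_
  have hα0 : α - 1 ≠ 0 := by linarith
  rw [Nat.cast_min]
  congr 1
  field_simp
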